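/- **Model.** Let $G$ be a graph on $n$ nodes. In the asynchronous push-pull protocol a rumor is known at time $0$ to one start node $s$ only. Every node carries a clock that rings at the times of a Poisson process of rate $1$, independently for different nodes; whenever the clock of $v$ rings, $v$ contacts a neighbour $w$ chosen uniformly at random (independently of everything else), and if one of $v,w$ knows the rumor, then both know it from then on. Let $T(G)=T(G,s)\in[0,\infty]$ be the first time at which all nodes know the rumor, and let $\mathbb E[T(G)]$ be its expectation over the protocol only, the graph being fixed. Let $G_{n,p}$ be the random graph on $n$ nodes in which every edge is present independently with probability $p$, write $H_m=\sum_{j=1}^m 1/j$, and let "w.h.p." mean "with probability tending to $1$ as $n\to\infty$". **Theorem.** Let $\alpha:\mathbb N\to\mathbb R$ with $\alpha(n)\to\infty$. There is a constant $C$ such that the following holds. (a) Suppose $p=p(n)=\alpha(n)\ln(n)/n\le 1$ for all large $n$. Then w.h.p. (over the graph) for every start node $$\mathbb E[T(G_{n,p})]=y+\eta\quad\text{with}\quad |y-H_{n-1}|<\sqrt{34/\alpha(n)}\,H_{n-1},\qquad |\eta|\le C\,\frac{\ln n}{n}$$ (in particular the expectation is finite). Moreover, for every function $\psi(n)\to\infty$,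 w.h.p. (over graph and protocol) $$\bigl|T(G_{n,p})-\mathbb E[T(G_{n,p})]\bigr|\le C\,\alpha(n)^{-1/2}\ln(n)+\psi(n),$$ uniformly over the choice of the start node, which may depend on the graph. (b) Both bounds hold for every graph with uniform cuts: call a graph $G$ on $n$ nodes *uniform* if for every set $S$ of nodes the number $e(S,S^c)$ of edges between $S$ and its complement satisfies $$\bigl|e(S,S^c)-q\,|S|(n-|S|)\bigr|\le\sqrt{8/\alpha(n)}\;q\,|S|(n-|S|),\qquad q=\alpha(n)\ln(n)/n .$$ Then for all sufficiently large $n$, every uniform graph $G$ on $n$ nodes and every start node, $\mathbb E[T(G)]$ satisfies the bound of (a) with the same $C$; and for every $\psi(n)\to\infty$ and $\delta>0$, for all sufficiently large $n$, every uniform graph $G$ on $n$ nodes and every start node, $|T(G)-\mathbb E[T(G)]|\le C\alpha(n)^{-1/2}\ln(n)+\psi(n)$ with probability at least $1-\delta$. -/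

import Mathlib

open MeasureTheory ProbabilityTheory Filter Topology
open scoped ENNReal unitInterval

namespace RumorSpreading

/-- The law of the node contacted by `v` at a ring of its clock: uniform on the neighbourhood of
`v`. An isolated node has nobody to contact; it contacts itself, which has no effect. -/
noncomputable def contactLaw {n : ℕ} (G : SimpleGraph (Fin n)) (v : Fin n) : Measure (Fin n) :=
  open scoped Classical in
  if (G.neighborSet v).Nonempty then uniformOn (G.neighborSet v) else Measure.dirac v

/-- A realization of all clocks and contacts. For `ω (v, k) = (x, w)`, `x` is the waiting time
between the `k`-th and the `(k+1)`-st ring of the clock of `v` (between time `0` and the first ring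
if `k = 0`), and `w` is the node that `v` contacts at its `(k+1)`-st ring. -/
abbrev Realization (n : ℕ) : Type := Fin n × ℕ → ℝ × Fin n

/-- The law of clocks and contacts. The waiting times are independent and exponential with
parameter `1`, so the rings of the nodes form independent Poisson processes of rate `1`; the
contacts are independent of the clocks and of each other, and uniform among the neighbours. -/
noncomputable def protocolLaw {n : ℕ} (G : SimpleGraph (Fin n)) : Measure (Realization n) :=
  Measure.infinitePi fun i : Fin n × ℕ => (expMeasure 1).prod (contactLaw G i.1)

/-- The time of the `(k+1)`-st ring of the clock of `v`. -/
def ringTime {n : ℕ} (ω : Realization n) (v : Fin n) (k : ℕ) : ℝ :=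
  ∑ i ∈ Finset.range (k + 1), (ω (v, i)).1

/-- `Informed ω s v t`: the node `v` knows the rumor at time `t`, if it starts at `s` at time `0`.
When the clock of `v` rings, `v` contacts a node `w`; if `v` knows the rumor then `w` learns it
(push), and if `w` knows the rumor then `v` learns it (pull). -/
inductive Informed {n : ℕ} (ω : Realization n) (s : Fin n) : Fin n → ℝ → Prop
  | start (t : ℝ) (ht : 0 ≤ t) : Informed ω s s t
  | push (v : Fin n) (k : ℕ) (t : ℝ) (hv : Informed ω s v (ringTime ω v k))
      (ht : ringTime ω v k ≤ t) : Informed ω s (ω (v, k)).2 t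
  | pull (v : Fin n) (k : ℕ) (t : ℝ) (hw : Informed ω s (ω (v, k)).2 (ringTime ω v k))
      (ht : ringTime ω v k ≤ t) : Informed ω s v t

/-- The spreading time `T`: the first time at which all nodes are informed (`∞` if there is
none). -/
noncomputable def spreadTime {n : ℕ} (s : Fin n) (ω : Realization n) : ℝ≥0∞ :=
  ⨅ (t : ℝ) (_ : ∀ v, Informed ω s v t), ENNReal.ofReal t

/-- The expectation of the spreading time on the graph `G`, over the randomness of the protocol. -/
noncomputable def meanSpreadTime {n : ℕ} (G : SimpleGraph (Fin n)) (s : Fin n) : ℝ≥0∞ :=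
  ∫⁻ ω, spreadTime s ω ∂(protocolLaw G)

/-- With `p = a ln n / n`, the number of edges of `G` between any set `S` of nodes and its
complement is within a factor `1 ± √(8 / a)` of `p |S| (n - |S|)`. -/
def UniformCuts {n : ℕ} (G : SimpleGraph (Fin n)) (a : ℝ) : Prop :=
  open scoped Classical in
  ∀ S : Finset (Fin n),
    |((G.interedges S Sᶜ).card : ℝ) - a * Real.log n / n * S.card * (n - S.card)|
      ≤ √(8 / a) * (a * Real.log n / n * S.card * (n - S.card))

/-- The expectation of the spreading time is finite and equals
`(1 ± √(34 / a)) H_{n-1}` up to an error of at most `C ln n / n`. -/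
def MeanBound {n : ℕ} (C a : ℝ) (G : SimpleGraph (Fin n)) (s : Fin n) : Prop :=
  meanSpreadTime G s ≠ ∞ ∧
    ∃ y : ℝ, |y - (harmonic (n - 1) : ℝ)| < √(34 / a) * (harmonic (n - 1) : ℝ) ∧
      |(meanSpreadTime G s).toReal - y| ≤ C * (Real.log n / n)

/-- The event that the spreading time and its expectation are finite and differ by at most `r`. -/
def concentrationEvent {n : ℕ} (r : ℝ) (G : SimpleGraph (Fin n)) (s : Fin n) :
    Set (Realization n) :=
  {ω | meanSpreadTime G s ≠ ∞ ∧ spreadTime s ω ≠ ∞ ∧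
    |(spreadTime s ω).toReal - (meanSpreadTime G s).toReal| ≤ r}

instance contactLaw_isProbabilityMeasure {n : ℕ} (G : SimpleGraph (Fin n)) (v : Fin n) :
    IsProbabilityMeasure (contactLaw G v) := by
  unfold contactLaw
  split_ifs with h
  · exact isProbabilityMeasure_uniformOn (Set.toFinite _) h
  · infer_instance

instance protocolLaw_isProbabilityMeasure {n : ℕ} (G : SimpleGraph (Fin n)) :
    IsProbabilityMeasure (protocolLaw G) := by
  have := isProbabilityMeasure_expMeasure one_pos
  unfold protocolLaw
  infer_instance

end RumorSpreading

namespace RumorSpreading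

variable {n : ℕ}

/-! ### The exponential distribution -/

/-! An informed set grows only when a contact crosses its cut. In the complete graph a set of size k
grows at rate 2k(n-k)/(n-1). The reciprocals of these rates sum to A = (n-1)/n · H_{n-1} and their
squares have a bounded sum, so T is a sum of independent exponential variables with mean A and
bounded variance. In a graph with uniform cuts let ε = √(8/a). An edge of a cut contributes to the
growth rate the reciprocals of the degrees of its two ends, and degrees are cuts of singletons.
Hence all growth rates, although they depend on the whole set and not only on its size, are within a
factor r = (1-ε)/(1+ε) of the complete ones (`UniformCuts.growthRate_mem`).

No coupling is needed to compare T with sums of exponential variables. The exponential moment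
`expMoment` of the remaining sum, as a function of the size of the informed set, is superharmonic
for the process if θ > 0 and its rates are lower bounds for the growth rates, or if θ < 0 and they
are upper bounds (`sum_lintegral_expMoment_le`). This bounds E exp(θT) for both signs of θ
(`spreadTime_exponential_moment`). Letting θ tend to 0 places E T in [rA, A/r]; θ = ±1/4 gives
exponential tails outside this interval, whose width is O(ln n / √a) (`spreadTime_mean_and_tail`).

The only Markov property used is the one at the first ring (`lintegral_ringsFirst`): each node rings
first with probability 1/n, after an exponential time of rate n, and by memorylessness a fresh
realization remains. `ringFunctional` iterates this step. With constant weights it shows that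
finitely many rings suffice almost surely; with weights exp(θx) it converges to exp(θT), and Fatou's
lemma transfers the bounds.

A random graph has uniform cuts w.h.p. by a Chernoff bound and a union bound over the sets of at
most n/2 nodes (`binomialRandom_not_uniformCuts_le`), so the statement on random graphs follows from
the one on uniform graphs. -/

lemma lintegral_expMeasure (r : ℝ) {f : ℝ → ℝ≥0∞} (hf : Measurable f) :
    ∫⁻ t, f t ∂(expMeasure r) =
      ∫⁻ t in Set.Ioi 0, ENNReal.ofReal (r * Real.exp (-(r * t))) * f t := by
  have h1 : ∫⁻ t, f t ∂(expMeasure r) = ∫⁻ t, exponentialPDF r t * f t := by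
    have hm : Measurable (exponentialPDF r) :=
      (measurable_exponentialPDFReal r).ennreal_ofReal
    exact lintegral_withDensity_eq_lintegral_mul _ hm hf
  rw [h1, ← lintegral_indicator measurableSet_Ioi]
  have h0 : ∀ᵐ t : ℝ, t ≠ 0 := by
    simp [ae_iff]
  refine lintegral_congr_ae ?_
  filter_upwards [h0] with t ht
  rcases lt_or_gt_of_ne ht with h | h
  · rw [exponentialPDF_of_neg h, Set.indicator_of_notMem (by simpa using h.le), zero_mul]
  · rw [exponentialPDF_of_nonneg h.le, Set.indicator_of_mem (by simpa using h)]

/-- Exponential tilting of an exponential distribution changes its rate. -/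
lemma lintegral_exp_mul_expMeasure {r c : ℝ} (hr : 0 < r) (hc : 0 < r + c) {f : ℝ → ℝ≥0∞}
    (hf : Measurable f) :
    ∫⁻ t, ENNReal.ofReal (Real.exp (-(c * t))) * f t ∂(expMeasure r) =
      ENNReal.ofReal (r / (r + c)) * ∫⁻ t, f t ∂(expMeasure (r + c)) := by
  rw [lintegral_expMeasure r (by fun_prop), lintegral_expMeasure (r + c) hf,
    ← lintegral_const_mul _ (by fun_prop)]
  refine lintegral_congr fun t => ?_
  rw [← mul_assoc, ← mul_assoc, ← ENNReal.ofReal_mul (by positivity),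
    ← ENNReal.ofReal_mul (by positivity)]
  congr 2
  rw [mul_assoc, ← Real.exp_add]
  field_simp
  ring_nf

lemma lintegral_ofReal_exp_expMeasure {r θ : ℝ} (hr : 0 < r) (hθ : θ < r) :
    ∫⁻ t, ENNReal.ofReal (Real.exp (θ * t)) ∂(expMeasure r) = ENNReal.ofReal (r / (r - θ)) := by
  have h := lintegral_exp_mul_expMeasure (r := r) (c := -θ) hr (by linarith) (f := fun _ => 1)
    measurable_const
  have := isProbabilityMeasure_expMeasure (r := r + -θ) (by linarith)
  simpa [sub_eq_add_neg] using h

/-- The exponential distribution is memoryless. -/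
lemma lintegral_indicator_Ioi_sub_expMeasure {x : ℝ} (hx : 0 ≤ x) {f : ℝ → ℝ≥0∞}
    (hf : Measurable f) :
    ∫⁻ t, (Set.Ioi x).indicator (fun t => f (t - x)) t ∂(expMeasure 1) =
      ENNReal.ofReal (Real.exp (-x)) * ∫⁻ t, f t ∂(expMeasure 1) := by
  have hg : Measurable fun t => (Set.Ioi x).indicator (fun t => f (t - x)) t :=
    (hf.comp (measurable_id.sub_const x)).indicator measurableSet_Ioi
  rw [lintegral_expMeasure 1 hg, lintegral_expMeasure 1 hf,
    ← lintegral_const_mul _ (by fun_prop), ← lintegral_indicator measurableSet_Ioi,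
    ← lintegral_indicator measurableSet_Ioi]
  conv_rhs => rw [← lintegral_sub_right_eq_self _ x]
  refine lintegral_congr fun t => ?_
  by_cases h : x < t
  · rw [Set.indicator_of_mem (by simp; linarith), Set.indicator_of_mem (by simpa using h),
      Set.indicator_of_mem (by simpa using h), ← mul_assoc,
      ← ENNReal.ofReal_mul (by positivity)]
    congr 2
    rw [one_mul, one_mul, one_mul, ← Real.exp_add]
    ring_nf
  · have h2 : t ∉ Set.Ioi x := by simpa using h
    rw [Set.indicator_of_notMem (s := Set.Ioi 0) (a := t - x) (by simpa using h)]
    by_cases h3 : 0 < t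
    · rw [Set.indicator_of_mem (by simpa using h3), Set.indicator_of_notMem h2, mul_zero]
    · rw [Set.indicator_of_notMem (by simpa using h3)]

lemma ae_pos_expMeasure (r : ℝ) : ∀ᵐ t ∂(expMeasure r), 0 < t := by
  have h := lintegral_expMeasure r (f := (Set.Iic (0 : ℝ)).indicator 1)
    (measurable_one.indicator measurableSet_Iic)
  rw [lintegral_indicator_one measurableSet_Iic] at h
  have h2 : ∫⁻ t in Set.Ioi 0, ENNReal.ofReal (r * Real.exp (-(r * t))) *
      (Set.Iic (0 : ℝ)).indicator (1 : ℝ → ℝ≥0∞) t = 0 := by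
    rw [setLIntegral_congr_fun (g := 0) measurableSet_Ioi]
    · simp
    · intro t ht
      have : t ∉ Set.Iic (0 : ℝ) := by simpa using ht
      simp [Set.indicator_of_notMem this]
  rw [h2] at h
  rw [ae_iff]
  convert h using 2
  ext t
  simp

/-! ### The Markov property at the first ring -/

/-- The law of one waiting time of `v` together with the node contacted at its end. -/
noncomputable def ringLaw (G : SimpleGraph (Fin n)) (v : Fin n) : Measure (ℝ × Fin n) :=
  (expMeasure 1).prod (contactLaw G v)

instance (G : SimpleGraph (Fin n)) (v : Fin n) : IsProbabilityMeasure (ringLaw G v) := by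
  have := isProbabilityMeasure_expMeasure one_pos
  unfold ringLaw
  infer_instance

lemma protocolLaw_eq (G : SimpleGraph (Fin n)) :
    protocolLaw G = Measure.infinitePi fun i : Fin n × ℕ => ringLaw G i.1 := rfl

/-- The clock of `v` is the first to ring. -/
def RingsFirst (v : Fin n) (ω : Realization n) : Prop :=
  ∀ u, u ≠ v → (ω (v, 0)).1 < (ω (u, 0)).1

/-- What remains of the realization after time `x`, if `v` rings once until then and no other node
rings. -/
def residual (v : Fin n) (x : ℝ) (ω : Realization n) : Realization n := fun i =>
  if i.1 = v then ω (v, i.2 + 1) else if i.2 = 0 then ((ω i).1 - x, (ω i).2) else ω i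

/-- Skip the first ring of `v` in the numbering of the rings. -/
def skipFirst (v : Fin n) (i : Fin n × ℕ) : Fin n × ℕ := if i.1 = v then (i.1, i.2 + 1) else i

lemma skipFirst_fst (v : Fin n) (i : Fin n × ℕ) : (skipFirst v i).1 = i.1 := by
  unfold skipFirst; split_ifs <;> rfl

lemma measurable_residual (v : Fin n) :
    Measurable fun q : ℝ × Realization n => residual v q.1 q.2 := by
  refine measurable_pi_iff.2 fun i => ?_
  unfold residual
  split_ifs <;> fun_prop

lemma measurable_residual_const (v : Fin n) (x : ℝ) : Measurable (residual v x) :=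
  (measurable_residual v).comp (by fun_prop : Measurable fun ω : Realization n => (x, ω))

lemma measurableSet_ringsFirst (v : Fin n) :
    MeasurableSet {ω : Realization n | RingsFirst v ω} := by
  have : {ω : Realization n | RingsFirst v ω} =
      ⋂ u, ⋂ (_ : u ≠ v), {ω | (ω (v, 0)).1 < (ω (u, 0)).1} := by
    ext ω; simp [RingsFirst]
  rw [this]
  exact MeasurableSet.iInter fun u => MeasurableSet.iInter fun _ =>
    measurableSet_lt (by fun_prop) (by fun_prop)

/-- The factors of the product law depend on the node only, so an injective reindexing that keeps
the node preserves the law. -/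
lemma map_skipFirst_protocolLaw (G : SimpleGraph (Fin n)) (v : Fin n) :
    (protocolLaw G).map (fun ω i => ω (skipFirst v i)) = protocolLaw G := by
  classical
  set τ : Fin n × ℕ → Fin n × ℕ := fun j => if j.1 = v then (j.1, j.2 - 1) else j with hτ
  have hl : Function.LeftInverse τ (skipFirst v) := by
    intro i
    by_cases h : i.1 = v <;> simp [hτ, skipFirst, h]
    rw [← h]
  conv_rhs => rw [protocolLaw_eq]
  refine Measure.eq_infinitePi _ fun s t ht => ?_
  rw [Measure.map_apply (by fun_prop) (.pi s.countable_toSet fun _ _ => ht _)]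
  have hpre : (fun (ω : Realization n) i => ω (skipFirst v i)) ⁻¹' (Set.pi s t) =
      Set.pi (s.image (skipFirst v)) fun j => t (τ j) := by
    ext ω
    simp only [Set.mem_preimage, Set.mem_pi, Finset.coe_image, Set.mem_image,
      forall_exists_index, and_imp, forall_apply_eq_imp_iff₂, hl _]
  rw [hpre, protocolLaw_eq, Measure.infinitePi_pi _ fun _ _ => ht _,
    Finset.prod_image fun _ _ _ _ h => hl.injective h]
  simp only [hl _, skipFirst_fst]

lemma ringLaw_shift (G : SimpleGraph (Fin n)) (u : Fin n) {x : ℝ} (hx : 0 ≤ x)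
    {B : Set (ℝ × Fin n)} (hB : MeasurableSet B) :
    ringLaw G u {y | x < y.1 ∧ (y.1 - x, y.2) ∈ B} =
      ENNReal.ofReal (Real.exp (-x)) * ringLaw G u B := by
  have hm : MeasurableSet {y : ℝ × Fin n | x < y.1 ∧ (y.1 - x, y.2) ∈ B} :=
    (measurableSet_lt measurable_const measurable_fst).inter
      (hB.preimage (by fun_prop : Measurable fun y : ℝ × Fin n => (y.1 - x, y.2)))
  have := isProbabilityMeasure_expMeasure one_pos
  rw [ringLaw, Measure.prod_apply hm, Measure.prod_apply hB,
    ← lintegral_indicator_Ioi_sub_expMeasure hx (measurable_measure_prodMk_left hB)]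
  refine lintegral_congr fun t => ?_
  by_cases h : x < t
  · rw [Set.indicator_of_mem (by simpa using h)]
    congr 1
    ext w
    simp [h]
  · rw [Set.indicator_of_notMem (by simpa using h)]
    simp [h]

/-- Given that only `v` rings until time `x`, what remains has the law of the whole. -/
lemma protocolLaw_residual (G : SimpleGraph (Fin n)) (v : Fin n) {x : ℝ} (hx : 0 ≤ x) :
    ((protocolLaw G).restrict {ω | ∀ u, u ≠ v → x < (ω (u, 0)).1}).map (residual v x) =
      ENNReal.ofReal (Real.exp (-((n - 1 : ℝ) * x))) • protocolLaw G := by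
  classical
  set c := ENNReal.ofReal (Real.exp (-((n - 1 : ℝ) * x))) with hc
  have hc0 : c ≠ 0 := by simp [hc, Real.exp_pos]
  have hct : c ≠ ∞ := ENNReal.ofReal_ne_top
  have hmr : Measurable (residual v x) := measurable_residual_const v x
  set Z : Finset (Fin n × ℕ) := (Finset.univ.erase v).image fun u => (u, 0) with hZ
  have hZc : c = ENNReal.ofReal (Real.exp (-x)) ^ Z.card := by
    have hn : 1 ≤ n := by have := v.2; omega
    rw [hZ, Finset.card_image_of_injective _ (fun a b h => by simpa using h),
      Finset.card_erase_of_mem (Finset.mem_univ _), Finset.card_univ, Fintype.card_fin,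
      ← ENNReal.ofReal_pow (Real.exp_pos _).le, ← Real.exp_nat_mul, hc]
    push_cast [hn]
    ring_nf
  have hmem : ∀ i, i ∈ Z ↔ i.1 ≠ v ∧ i.2 = 0 := by
    rintro ⟨u, k⟩
    simp [hZ, eq_comm]
  -- Normalized by the probability `c` of the event, the measure can be identified as an infinite
  -- product by its values on finite boxes.
  have key : c⁻¹ • (((protocolLaw G).restrict {ω | ∀ u, u ≠ v → x < (ω (u, 0)).1}).map
      (residual v x)) = protocolLaw G := by
    conv_rhs => rw [protocolLaw_eq]
    refine Measure.eq_infinitePi _ fun s t ht => ?_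
    have hmE : MeasurableSet {ω : Realization n | ∀ u, u ≠ v → x < (ω (u, 0)).1} := by
      have : {ω : Realization n | ∀ u, u ≠ v → x < (ω (u, 0)).1} =
          ⋂ u, ⋂ (_ : u ≠ v), {ω | x < (ω (u, 0)).1} := by
        ext ω; simp
      rw [this]
      exact MeasurableSet.iInter fun u => MeasurableSet.iInter fun _ =>
        measurableSet_lt (by fun_prop) (by fun_prop)
    have hmp : MeasurableSet (Set.pi (s : Set (Fin n × ℕ)) t) :=
      .pi s.countable_toSet fun _ _ => ht _
    -- The event constrains every coordinate in `Z`, also those outside `s`; there the box is padded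
    -- with the whole space.
    set t' : Fin n × ℕ → Set (ℝ × Fin n) := fun i => if i ∈ s then t i else Set.univ with ht'
    have ht'm : ∀ i, MeasurableSet (t' i) := by
      intro i; simp only [ht']; split_ifs
      · exact ht i
      · exact MeasurableSet.univ
    set B : Fin n × ℕ → Set (ℝ × Fin n) := fun i =>
      if i ∈ Z then {y | x < y.1 ∧ (y.1 - x, y.2) ∈ t' i} else t' i with hB
    have hBm : ∀ i, MeasurableSet (B i) := by
      intro i; simp only [hB]; split_ifs
      · exact (measurableSet_lt measurable_const measurable_fst).inter
          ((ht'm i).preimage (by fun_prop : Measurable fun y : ℝ × Fin n => (y.1 - x, y.2)))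
      · exact ht'm i
    have hset : residual v x ⁻¹' (Set.pi s t) ∩ {ω | ∀ u, u ≠ v → x < (ω (u, 0)).1} =
        (fun (ω : Realization n) i => ω (skipFirst v i)) ⁻¹' (Set.pi (s ∪ Z : Finset _) B) := by
      ext ω
      simp only [Set.mem_inter_iff, Set.mem_preimage, Set.mem_pi, Finset.mem_coe,
        Finset.mem_union, Set.mem_ofPred_eq]
      have hres : ∀ i, residual v x ω i = if i ∈ Z then ((ω (skipFirst v i)).1 - x,
          (ω (skipFirst v i)).2) else ω (skipFirst v i) := by
        rintro ⟨u, k⟩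
        by_cases hu : u = v
        · subst hu; simp [residual, skipFirst, hmem]
        · simp [residual, skipFirst, hmem, hu]
      constructor
      · rintro ⟨h1, h2⟩ i hi
        have hti : residual v x ω i ∈ t' i := by
          simp only [ht']
          split_ifs with h
          · exact h1 i h
          · trivial
        rw [hres] at hti
        simp only [hB]
        by_cases hiZ : i ∈ Z
        · simp only [hiZ, if_true] at hti ⊢
          refine ⟨?_, hti⟩
          obtain ⟨u, k⟩ := i
          obtain ⟨hu, hk⟩ := (hmem _).1 hiZ
          dsimp only at hu hk
          subst hk
          simpa [skipFirst, hu] using h2 u hu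
        · simpa only [hiZ, if_false] using hti
      · intro h
        constructor
        · intro i hi
          have := h i (Or.inl hi)
          rw [hres]
          by_cases hiZ : i ∈ Z
          · simp only [hB, ht', hiZ, hi, if_true] at this ⊢
            exact this.2
          · simpa only [hB, ht', hiZ, hi, if_true, if_false] using this
        · intro u hu
          have hiZ : (u, 0) ∈ Z := (hmem _).2 ⟨hu, rfl⟩
          have := h (u, 0) (Or.inr hiZ)
          simp only [hB, hiZ, if_true, skipFirst, hu, if_false] at this
          exact this.1
    rw [Measure.smul_apply, Measure.map_apply hmr hmp, Measure.restrict_apply (hmr hmp), hset,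
      ← Measure.map_apply (by fun_prop) (.pi (Finset.countable_toSet _) fun _ _ => hBm _),
      map_skipFirst_protocolLaw, protocolLaw_eq, Measure.infinitePi_pi _ fun _ _ => hBm _]
    have hfac : ∀ i, ringLaw G i.1 (B i) =
        (if i ∈ Z then ENNReal.ofReal (Real.exp (-x)) else 1) * ringLaw G i.1 (t' i) := by
      intro i
      by_cases hi : i ∈ Z
      · simp only [hB, hi, if_true]
        exact ringLaw_shift G _ hx (ht'm i)
      · simp [hB, hi]
    simp only [hfac]
    rw [Finset.prod_mul_distrib, Finset.prod_ite_mem, Finset.inter_eq_right.2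
      Finset.subset_union_right, Finset.prod_const, ← hZc, smul_eq_mul, ← mul_assoc,
      ENNReal.inv_mul_cancel hc0 hct, one_mul]
    rw [← Finset.prod_subset (Finset.subset_union_left (s₁ := s) (s₂ := Z))]
    · exact Finset.prod_congr rfl fun i hi => by simp [ht', hi]
    · intro i _ hi
      simp [ht', hi]
  conv_rhs => rw [← key]
  rw [smul_smul, ENNReal.mul_inv_cancel hc0 hct, one_smul]

/-- Resampling one coordinate independently preserves a product law. This lets Fubini integrate the
first ring of a node separately from all the rest. -/
lemma protocolLaw_update (G : SimpleGraph (Fin n)) (i₀ : Fin n × ℕ) :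
    ((ringLaw G i₀.1).prod (protocolLaw G)).map
      (fun q : (ℝ × Fin n) × Realization n => Function.update q.2 i₀ q.1) = protocolLaw G := by
  classical
  conv_rhs => rw [protocolLaw_eq]
  have hm : Measurable fun q : (ℝ × Fin n) × Realization n => Function.update q.2 i₀ q.1 := by
    refine measurable_pi_iff.2 fun i => ?_
    by_cases h : i = i₀
    · subst h; simpa using measurable_fst
    · simp only [Function.update_of_ne h]; fun_prop
  refine Measure.eq_infinitePi _ fun s t ht => ?_
  rw [Measure.map_apply hm (.pi s.countable_toSet fun _ _ => ht _)]
  have hpre : (fun q : (ℝ × Fin n) × Realization n => Function.update q.2 i₀ q.1) ⁻¹'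
      (Set.pi s t) = (if i₀ ∈ s then t i₀ else Set.univ) ×ˢ
        Set.pi ((s.erase i₀ : Finset _) : Set (Fin n × ℕ)) t := by
    ext ⟨y, ω⟩
    simp only [Set.mem_preimage, Set.mem_pi, Set.mem_prod, Finset.mem_coe, Finset.mem_erase]
    constructor
    · intro h
      constructor
      · split_ifs with h0
        · simpa using h i₀ h0
        · trivial
      · rintro i ⟨hi, his⟩
        simpa [Function.update_of_ne hi] using h i his
    · rintro ⟨h1, h2⟩ i hi
      by_cases h : i = i₀
      · subst h; simpa [hi] using h1
      · simpa [Function.update_of_ne h] using h2 i ⟨h, hi⟩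
  rw [hpre, Measure.prod_prod, protocolLaw_eq, Measure.infinitePi_pi _ fun _ _ => ht _]
  split_ifs with h0
  · exact Finset.mul_prod_erase s (fun i => ringLaw G i.1 (t i)) h0
  · rw [Finset.erase_eq_of_notMem h0, measure_univ, one_mul]

/-- The Markov property at the first ring: on the event that `v` rings first, the time of the ring
is exponential with rate `n`, the contact is uniform, and what remains is a fresh realization. -/
lemma lintegral_ringsFirst (G : SimpleGraph (Fin n)) (v : Fin n)
    {g : (ℝ × Fin n) × Realization n → ℝ≥0∞} (hg : Measurable g) :
    ∫⁻ ω, {ω | RingsFirst v ω}.indicator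
        (fun ω => g (ω (v, 0), residual v (ω (v, 0)).1 ω)) ω ∂(protocolLaw G) =
      ENNReal.ofReal (1 / n) * ∫⁻ x, ∫⁻ w, ∫⁻ ω, g ((x, w), ω) ∂(protocolLaw G)
        ∂(contactLaw G v) ∂(expMeasure n) := by
  classical
  have hn : 1 ≤ n := by have := v.2; omega
  have hn' : (0 : ℝ) < n := by exact_mod_cast hn
  have hmu : Measurable fun q : (ℝ × Fin n) × Realization n =>
      Function.update q.2 (v, 0) q.1 := by
    refine measurable_pi_iff.2 fun i => ?_
    by_cases h : i = (v, 0)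
    · subst h; simpa using measurable_fst
    · simp only [Function.update_of_ne h]; fun_prop
  have hmI : Measurable fun ω : Realization n => {ω | RingsFirst v ω}.indicator
      (fun ω => g (ω (v, 0), residual v (ω (v, 0)).1 ω)) ω := by
    refine Measurable.indicator ?_ (measurableSet_ringsFirst v)
    refine hg.comp (Measurable.prodMk (by fun_prop) ?_)
    exact (measurable_residual v).comp
      (by fun_prop : Measurable fun ω : Realization n => ((ω (v, 0)).1, ω))
  conv_lhs => rw [← protocolLaw_update G (v, 0)]
  rw [lintegral_map hmI hmu, lintegral_prod _ (by exact (hmI.comp hmu).aemeasurable)]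
  have hinner : ∀ y : ℝ × Fin n, 0 ≤ y.1 →
      ∫⁻ ω, {ω | RingsFirst v ω}.indicator
        (fun ω => g (ω (v, 0), residual v (ω (v, 0)).1 ω)) (Function.update ω (v, 0) y)
          ∂(protocolLaw G) =
      ENNReal.ofReal (Real.exp (-((n - 1 : ℝ) * y.1))) * ∫⁻ ω, g (y, ω) ∂(protocolLaw G) := by
    intro y hy
    have hmr : Measurable (residual v y.1) := measurable_residual_const v y.1
    have h := protocolLaw_residual G v hy
    have h2 := congrArg (fun μ : Measure (Realization n) => ∫⁻ ω, g (y, ω) ∂μ) h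
    rw [lintegral_map (by fun_prop) hmr, lintegral_smul_measure, smul_eq_mul] at h2
    rw [← h2, ← lintegral_indicator]
    · refine lintegral_congr fun ω => ?_
      have hres : residual v y.1 (Function.update ω (v, 0) y) = residual v y.1 ω := by
        funext ⟨u, k⟩
        by_cases hu : u = v
        · simp [residual, hu]
        · simp [residual, hu, Function.update_of_ne]
      have hev : Function.update ω (v, 0) y ∈ {ω : Realization n | RingsFirst v ω} ↔
          ω ∈ {ω : Realization n | ∀ u, u ≠ v → y.1 < (ω (u, 0)).1} := by
        simp only [RingsFirst, Set.mem_ofPred_eq, Function.update_self]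
        refine forall_congr' fun u => imp_congr_right fun hu => ?_
        rw [Function.update_of_ne (by simpa using hu)]
      by_cases hω : Function.update ω (v, 0) y ∈ {ω : Realization n | RingsFirst v ω}
      · rw [Set.indicator_of_mem hω, Set.indicator_of_mem (hev.1 hω), Function.update_self, hres]
      · rw [Set.indicator_of_notMem hω, Set.indicator_of_notMem (fun h => hω (hev.2 h))]
    · have : {ω : Realization n | ∀ u, u ≠ v → y.1 < (ω (u, 0)).1} =
          ⋂ u, ⋂ (_ : u ≠ v), {ω | y.1 < (ω (u, 0)).1} := by
        ext ω; simp
      rw [this]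
      exact MeasurableSet.iInter fun u => MeasurableSet.iInter fun _ =>
        measurableSet_lt (by fun_prop) (by fun_prop)
  have := isProbabilityMeasure_expMeasure one_pos
  have hgm : Measurable fun y : ℝ × Fin n => ∫⁻ ω, g (y, ω) ∂(protocolLaw G) :=
    hg.lintegral_prod_right'
  have hpos : ∀ᵐ y ∂(ringLaw G v), 0 ≤ y.1 := by
    have h : Measure.map Prod.fst (ringLaw G v) = expMeasure 1 := by
      simp [ringLaw, Measure.map_fst_prod]
    have h2 := ae_pos_expMeasure 1
    rw [← h] at h2
    filter_upwards [ae_of_ae_map measurable_fst.aemeasurable h2] with y hy using hy.le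
  rw [lintegral_congr_ae (hpos.mono fun y hy => hinner y hy), ringLaw, lintegral_prod]
  · have hout : ∀ x : ℝ, ∫⁻ w, ENNReal.ofReal (Real.exp (-((n - 1 : ℝ) * x))) *
        ∫⁻ ω, g ((x, w), ω) ∂(protocolLaw G) ∂(contactLaw G v) =
        ENNReal.ofReal (Real.exp (-((n - 1 : ℝ) * x))) *
          ∫⁻ w, ∫⁻ ω, g ((x, w), ω) ∂(protocolLaw G) ∂(contactLaw G v) := fun x =>
      lintegral_const_mul' _ _ ENNReal.ofReal_ne_top
    simp only [hout]
    -- The weight exp(-(n-1)x), the probability that the other n-1 clocks are silent until x, tilts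
    -- rate 1 to rate n at the cost of a factor 1/n.
    rw [lintegral_exp_mul_expMeasure one_pos (by linarith)]
    · congr 2
      · congr 1; ring
      · congr 1; ring
    · exact hgm.lintegral_prod_right'
  · exact Measurable.aemeasurable (by fun_prop)

/-! ### One step of the protocol -/

/-- `Informed` for a rumor that is known to all nodes of `S` at time `0`. -/
inductive InformedFrom (ω : Realization n) (S : Finset (Fin n)) : Fin n → ℝ → Prop
  | start (v : Fin n) (hv : v ∈ S) (t : ℝ) (ht : 0 ≤ t) : InformedFrom ω S v t
  | push (v : Fin n) (k : ℕ) (t : ℝ) (hv : InformedFrom ω S v (ringTime ω v k))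
      (ht : ringTime ω v k ≤ t) : InformedFrom ω S (ω (v, k)).2 t
  | pull (v : Fin n) (k : ℕ) (t : ℝ) (hw : InformedFrom ω S (ω (v, k)).2 (ringTime ω v k))
      (ht : ringTime ω v k ≤ t) : InformedFrom ω S v t

lemma informedFrom_singleton_iff {ω : Realization n} {s v : Fin n} {t : ℝ} :
    InformedFrom ω {s} v t ↔ Informed ω s v t := by
  constructor
  · intro h
    induction h with
    | start v hv t ht => rw [Finset.mem_singleton.1 hv]; exact .start t ht
    | push v k t _ ht ih => exact .push v k t ih ht
    | pull v k t _ ht ih => exact .pull v k t ih ht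
  · intro h
    induction h with
    | start t ht => exact .start s (Finset.mem_singleton_self s) t ht
    | push v k t _ ht ih => exact .push v k t ih ht
    | pull v k t _ ht ih => exact .pull v k t ih ht

/-- The set of informed nodes after `v` has contacted `w`, if it was `S` before. -/
def absorb (S : Finset (Fin n)) (v w : Fin n) : Finset (Fin n) :=
  if v ∈ S ∨ w ∈ S then insert v (insert w S) else S

lemma subset_absorb (S : Finset (Fin n)) (v w : Fin n) : S ⊆ absorb S v w := by
  intro u hu
  unfold absorb
  split_ifs
  · simp [hu]
  · exact hu

lemma mem_absorb_iff (S : Finset (Fin n)) (v w : Fin n) : v ∈ absorb S v w ↔ w ∈ absorb S v w := by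
  unfold absorb
  split_ifs with h
  · simp
  · push Not at h; simp [h.1, h.2]

/-- All waiting times are positive. -/
def PositiveWaits (ω : Realization n) : Prop := ∀ i, 0 < (ω i).1

section

variable {ω : Realization n} {v : Fin n}

lemma RingsFirst.positiveWaits_residual (hv : RingsFirst v ω) (hω : PositiveWaits ω) :
    PositiveWaits (residual v (ω (v, 0)).1 ω) := by
  rintro ⟨u, k⟩
  unfold residual
  dsimp only
  split_ifs with h1 h2
  · exact hω _
  · subst h2; have := hv u h1; dsimp only; linarith
  · exact hω _

lemma ringTime_succ_eq_residual (ω : Realization n) (v : Fin n) (k : ℕ) :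
    ringTime ω v (k + 1) = (ω (v, 0)).1 + ringTime (residual v (ω (v, 0)).1 ω) v k := by
  unfold ringTime
  rw [Finset.sum_range_succ', add_comm]
  simp [residual]

lemma ringTime_eq_residual_of_ne {u : Fin n} (hu : u ≠ v) (x : ℝ) (k : ℕ) :
    ringTime ω u k = x + ringTime (residual v x ω) u k := by
  unfold ringTime
  rw [Finset.sum_range_succ', Finset.sum_range_succ']
  simp only [residual, hu, if_false, Nat.add_eq_zero_iff, one_ne_zero, and_false, if_true]
  ring

lemma PositiveWaits.ringTime_pos (hω : PositiveWaits ω) (u : Fin n) (k : ℕ) :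
    0 < ringTime ω u k :=
  Finset.sum_pos (fun _ _ => hω _) ⟨0, by simp⟩

lemma ringTime_zero (ω : Realization n) (v : Fin n) : ringTime ω v 0 = (ω (v, 0)).1 := by
  simp [ringTime]

variable {S : Finset (Fin n)}

/-- The induction carries both halves because the premise of the first ring sits exactly at the time
of that ring, where the first half puts one party of the contact, hence both, into the absorbed set.
All other rings come later and are rings of the residual realization. -/
lemma RingsFirst.informedFrom_forward (hv : RingsFirst v ω) (hω : PositiveWaits ω) {u : Fin n}
    {t : ℝ} (h : InformedFrom ω S u t) :
    (t ≤ (ω (v, 0)).1 → u ∈ absorb S v (ω (v, 0)).2) ∧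
      ((ω (v, 0)).1 ≤ t →
        InformedFrom (residual v (ω (v, 0)).1 ω) (absorb S v (ω (v, 0)).2) u
          (t - (ω (v, 0)).1)) := by
  have hpos := hv.positiveWaits_residual hω
  induction h with
  | start u hu t ht =>
    exact ⟨fun _ => subset_absorb _ _ _ hu,
      fun h => .start u (subset_absorb _ _ _ hu) _ (by linarith)⟩
  | push u k t _ ht ih =>
    by_cases huv : u = v
    · subst huv
      cases k with
      | zero =>
        have h1 := (mem_absorb_iff _ _ _).1 (ih.1 (ringTime_zero ω u).le)
        exact ⟨fun _ => h1, fun h => .start _ h1 _ (by linarith)⟩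
      | succ k =>
        have hr := ringTime_succ_eq_residual ω u k
        have hp := hpos.ringTime_pos u k
        refine ⟨fun h => by linarith, fun h => ?_⟩
        have h1 := ih.2 (by linarith)
        rw [hr, add_sub_cancel_left] at h1
        have h2 := InformedFrom.push u k (t - (ω (u, 0)).1) h1 (by linarith)
        simpa [residual] using h2
    · have hr := ringTime_eq_residual_of_ne (ω := ω) huv (ω (v, 0)).1 k
      have hp := hpos.ringTime_pos u k
      refine ⟨fun h => by linarith, fun h => ?_⟩
      have h1 := ih.2 (by linarith)
      rw [hr, add_sub_cancel_left] at h1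
      have h2 := InformedFrom.push u k (t - (ω (v, 0)).1) h1 (by linarith)
      have h3 : (residual v (ω (v, 0)).1 ω (u, k)).2 = (ω (u, k)).2 := by
        simp only [residual, huv, if_false]; split_ifs <;> rfl
      rwa [h3] at h2
  | pull u k t _ ht ih =>
    by_cases huv : u = v
    · subst huv
      cases k with
      | zero =>
        have h1 := (mem_absorb_iff _ _ _).2 (ih.1 (ringTime_zero ω u).le)
        exact ⟨fun _ => h1, fun h => .start _ h1 _ (by linarith)⟩
      | succ k =>
        have hr := ringTime_succ_eq_residual ω u k
        have hp := hpos.ringTime_pos u k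
        refine ⟨fun h => by linarith, fun h => ?_⟩
        have h1 := ih.2 (by linarith)
        rw [hr, add_sub_cancel_left] at h1
        refine InformedFrom.pull u k (t - (ω (u, 0)).1) ?_ (by linarith)
        simpa [residual] using h1
    · have hr := ringTime_eq_residual_of_ne (ω := ω) huv (ω (v, 0)).1 k
      have hp := hpos.ringTime_pos u k
      refine ⟨fun h => by linarith, fun h => ?_⟩
      have h1 := ih.2 (by linarith)
      rw [hr, add_sub_cancel_left] at h1
      have h3 : (residual v (ω (v, 0)).1 ω (u, k)).2 = (ω (u, k)).2 := by
        simp only [residual, huv, if_false]; split_ifs <;> rfl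
      refine InformedFrom.pull u k (t - (ω (v, 0)).1) ?_ (by linarith)
      rwa [h3]

/-- The absorbed set is informed at the first ring, by a push or a pull between `v` and its contact;
every later ring only shifts in time. -/
lemma informedFrom_backward (hx : 0 ≤ (ω (v, 0)).1) {u : Fin n} {t : ℝ}
    (h : InformedFrom (residual v (ω (v, 0)).1 ω) (absorb S v (ω (v, 0)).2) u t) :
    InformedFrom ω S u ((ω (v, 0)).1 + t) := by
  induction h with
  | start u hu t ht =>
    unfold absorb at hu
    have hstart : ∀ u ∈ S, ∀ t, 0 ≤ t → InformedFrom ω S u t := fun u hu t ht => .start u hu t ht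
    have h0 := ringTime_zero ω v
    split_ifs at hu with hS
    · have hv : InformedFrom ω S v (ringTime ω v 0) := by
        rcases hS with hS | hS
        · exact hstart v hS _ (by linarith)
        · exact .pull v 0 _ (hstart _ hS _ (by linarith)) le_rfl
      have hw : InformedFrom ω S (ω (v, 0)).2 (ringTime ω v 0) := .push v 0 _ hv le_rfl
      rcases Finset.mem_insert.1 hu with rfl | hu
      · exact .pull u 0 _ hw (by linarith)
      rcases Finset.mem_insert.1 hu with rfl | hu
      · exact .push v 0 _ hv (by linarith)
      · exact hstart u hu _ (by linarith)
    · exact hstart u hu _ (by linarith)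
  | push u k t _ ht ih =>
    by_cases huv : u = v
    · subst huv
      rw [← ringTime_succ_eq_residual] at ih
      have := InformedFrom.push u (k + 1) ((ω (u, 0)).1 + t) ih
        (by rw [ringTime_succ_eq_residual]; linarith)
      simpa [residual] using this
    · rw [← ringTime_eq_residual_of_ne huv] at ih
      have h3 : (residual v (ω (v, 0)).1 ω (u, k)).2 = (ω (u, k)).2 := by
        simp only [residual, huv, if_false]; split_ifs <;> rfl
      rw [h3]
      exact .push u k _ ih (by rw [ringTime_eq_residual_of_ne huv (ω (v, 0)).1]; linarith)
  | pull u k t _ ht ih =>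
    by_cases huv : u = v
    · subst huv
      rw [← ringTime_succ_eq_residual] at ih
      refine InformedFrom.pull u (k + 1) ((ω (u, 0)).1 + t) ?_
        (by rw [ringTime_succ_eq_residual]; linarith)
      simpa [residual] using ih
    · have h3 : (residual v (ω (v, 0)).1 ω (u, k)).2 = (ω (u, k)).2 := by
        simp only [residual, huv, if_false]; split_ifs <;> rfl
      rw [← ringTime_eq_residual_of_ne huv, h3] at ih
      exact .pull u k _ ih (by rw [ringTime_eq_residual_of_ne huv (ω (v, 0)).1]; linarith)

lemma RingsFirst.le_ringTime (hv : RingsFirst v ω) (hω : PositiveWaits ω) (u : Fin n) (k : ℕ) :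
    (ω (v, 0)).1 ≤ ringTime ω u k := by
  have h1 : (ω (u, 0)).1 ≤ ringTime ω u k := by
    unfold ringTime
    exact Finset.single_le_sum (f := fun i => (ω (u, i)).1) (fun i _ => (hω (u, i)).le)
      (by simp : 0 ∈ Finset.range (k + 1))
  by_cases huv : u = v
  · rwa [huv] at h1 ⊢
  · exact (hv u huv).le.trans h1

lemma RingsFirst.mem_of_informedFrom (hv : RingsFirst v ω) (hω : PositiveWaits ω) {u : Fin n}
    {t : ℝ} (h : InformedFrom ω S u t) (ht : t < (ω (v, 0)).1) : u ∈ S := by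
  induction h with
  | start u hu => exact hu
  | push u k t _ ht' => exact absurd (hv.le_ringTime hω u k) (by linarith)
  | pull u k t _ ht' => exact absurd (hv.le_ringTime hω u k) (by linarith)

lemma PositiveWaits.nonneg_of_informedFrom (hω : PositiveWaits ω) {u : Fin n} {t : ℝ}
    (h : InformedFrom ω S u t) : 0 ≤ t := by
  induction h with
  | start u hu t ht => exact ht
  | push u k t _ ht' => exact (hω.ringTime_pos u k).le.trans ht'
  | pull u k t _ ht' => exact (hω.ringTime_pos u k).le.trans ht'

/-- The recursion for the spreading time: it is the time of the first ring plus the spreading time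
of what remains. It fails for the full set, which needs no ring at all. -/
lemma RingsFirst.forall_informedFrom_iff (hv : RingsFirst v ω) (hω : PositiveWaits ω)
    (hS : S ≠ Finset.univ) (t : ℝ) :
    (∀ u, InformedFrom ω S u t) ↔ (ω (v, 0)).1 ≤ t ∧
      ∀ u, InformedFrom (residual v (ω (v, 0)).1 ω) (absorb S v (ω (v, 0)).2) u
        (t - (ω (v, 0)).1) := by
  constructor
  · intro h
    have hx : (ω (v, 0)).1 ≤ t := by
      by_contra hlt
      push Not at hlt
      exact hS (Finset.eq_univ_iff_forall.2 fun u => hv.mem_of_informedFrom hω (h u) hlt)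
    exact ⟨hx, fun u => (hv.informedFrom_forward hω (h u)).2 hx⟩
  · rintro ⟨_, h⟩ u
    have := informedFrom_backward (hω _).le (h u)
    rwa [add_sub_cancel] at this

end

lemma ae_positiveWaits (G : SimpleGraph (Fin n)) : ∀ᵐ ω ∂(protocolLaw G), PositiveWaits ω := by
  refine ae_all_iff.2 fun i => ?_
  have h := Measure.infinitePi_map_eval (fun i : Fin n × ℕ => ringLaw G i.1) i
  have := isProbabilityMeasure_expMeasure one_pos
  have h2 : Measure.map Prod.fst (ringLaw G i.1) = expMeasure 1 := by
    simp [ringLaw, Measure.map_fst_prod]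
  rw [← h, ← protocolLaw_eq, Measure.map_map (by fun_prop) (by fun_prop)] at h2
  have h3 := ae_pos_expMeasure 1
  rw [← h2] at h3
  exact ae_of_ae_map (Measurable.aemeasurable (by fun_prop)) h3

/-- Almost surely there is a unique node that rings first. -/
lemma ae_exists_ringsFirst [NeZero n] (G : SimpleGraph (Fin n)) :
    ∀ᵐ ω ∂(protocolLaw G), ∃ v, RingsFirst v ω := by
  -- The Markov property with integrand 1 gives each node probability 1/n of ringing first; these n
  -- events are disjoint, so they exhaust the space.
  have hle : ∑ v : Fin n, protocolLaw G {ω | RingsFirst v ω} = 1 := by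
    have hn : (n : ℝ) ≠ 0 := by exact_mod_cast NeZero.ne n
    have hn' : (0 : ℝ) < n := by exact_mod_cast Nat.pos_of_ne_zero (NeZero.ne n)
    have := isProbabilityMeasure_expMeasure hn'
    have h : ∀ v : Fin n, protocolLaw G {ω | RingsFirst v ω} = ENNReal.ofReal (1 / n) := by
      intro v
      have h := lintegral_ringsFirst G v (g := fun _ => 1) measurable_const
      rw [lintegral_indicator (measurableSet_ringsFirst v)] at h
      simpa using h
    simp only [h, Finset.sum_const, Finset.card_univ, Fintype.card_fin, nsmul_eq_mul]
    rw [← ENNReal.ofReal_natCast, ← ENNReal.ofReal_mul hn'.le]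
    simp [hn]
  have hdisj : Pairwise (Function.onFun Disjoint fun v : Fin n => {ω | RingsFirst v ω}) := by
    intro v w hvw
    refine Set.disjoint_left.2 fun ω h1 h2 => ?_
    exact lt_asymm (h1 w hvw.symm) (h2 v hvw)
  have hU := measure_iUnion (μ := protocolLaw G) hdisj measurableSet_ringsFirst
  rw [tsum_fintype, hle] at hU
  have h2 := (prob_compl_eq_zero_iff (μ := protocolLaw G)
    (MeasurableSet.iUnion measurableSet_ringsFirst)).2 hU
  rw [ae_iff]
  convert h2 using 2
  ext ω
  simp

/-- What holds almost surely also holds almost surely after the first ring. -/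
lemma ae_residual (G : SimpleGraph (Fin n)) {q : Realization n → Prop}
    (hq : ∀ᵐ ω ∂(protocolLaw G), q ω) :
    ∀ᵐ ω ∂(protocolLaw G), ∀ v, RingsFirst v ω → q (residual v (ω (v, 0)).1 ω) := by
  refine ae_all_iff.2 fun v => ?_
  -- The exceptional set need not be measurable, so a measurable null set containing it takes its
  -- place.
  set N := toMeasurable (protocolLaw G) {ω | ¬ q ω} with hN
  have hN0 : protocolLaw G N = 0 := by rw [hN, measure_toMeasurable]; exact hq
  have hNm : MeasurableSet N := measurableSet_toMeasurable _ _
  have h := lintegral_ringsFirst G v (g := fun y => N.indicator 1 y.2)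
    ((measurable_one.indicator hNm).comp measurable_snd)
  simp only [lintegral_indicator_one hNm, hN0, lintegral_zero, mul_zero] at h
  have hm : Measurable fun ω : Realization n => {ω | RingsFirst v ω}.indicator
      (fun ω => N.indicator (1 : Realization n → ℝ≥0∞) (residual v (ω (v, 0)).1 ω)) ω := by
    refine Measurable.indicator ?_ (measurableSet_ringsFirst v)
    exact (measurable_one.indicator hNm).comp ((measurable_residual v).comp
      (by fun_prop : Measurable fun ω : Realization n => ((ω (v, 0)).1, ω)))
  filter_upwards [(lintegral_eq_zero_iff hm).1 h] with ω hω hv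
  by_contra hq'
  have h1 : residual v (ω (v, 0)).1 ω ∈ N := subset_toMeasurable _ _ hq'
  rw [Set.indicator_of_mem (by exact hv), Set.indicator_of_mem h1] at hω
  simp at hω

/-! ### Functionals of the sequence of rings -/

open scoped Classical in
/-- Follow the protocol until all nodes are informed, but for at most `m` rings; multiply the
weights `h x` of the times `x` between the rings with the value `c S` of the final set `S`. -/
noncomputable def ringFunctional (h : ℝ → ℝ≥0∞) (c : Finset (Fin n) → ℝ≥0∞) :
    ℕ → Finset (Fin n) → Realization n → ℝ≥0∞
  | 0, S, _ => c S
  | m + 1, S, ω => if S = Finset.univ then c S else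
      ∑ v, {ω | RingsFirst v ω}.indicator (fun ω => h (ω (v, 0)).1 *
        ringFunctional h c m (absorb S v (ω (v, 0)).2) (residual v (ω (v, 0)).1 ω)) ω

lemma measurable_ringFunctional_step {h : ℝ → ℝ≥0∞} (hh : Measurable h)
    {f : Finset (Fin n) → Realization n → ℝ≥0∞} (hf : ∀ S, Measurable (f S))
    (S : Finset (Fin n)) (v : Fin n) :
    Measurable fun y : (ℝ × Fin n) × Realization n => h y.1.1 * f (absorb S v y.1.2) y.2 := by
  have h1 : Measurable fun z : Realization n × Fin n => f (absorb S v z.2) z.1 :=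
    measurable_from_prod_countable_left fun w => hf (absorb S v w)
  exact (hh.comp (by fun_prop)).mul
    (h1.comp (by fun_prop : Measurable fun y : (ℝ × Fin n) × Realization n => (y.2, y.1.2)))

lemma measurable_indicator_ringsFirst (v : Fin n)
    {g : (ℝ × Fin n) × Realization n → ℝ≥0∞} (hg : Measurable g) :
    Measurable fun ω : Realization n => {ω | RingsFirst v ω}.indicator
      (fun ω => g (ω (v, 0), residual v (ω (v, 0)).1 ω)) ω := by
  refine Measurable.indicator ?_ (measurableSet_ringsFirst v)
  refine hg.comp (Measurable.prodMk (by fun_prop) ?_)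
  exact (measurable_residual v).comp
    (by fun_prop : Measurable fun ω : Realization n => ((ω (v, 0)).1, ω))

lemma measurable_ringFunctional {h : ℝ → ℝ≥0∞} (hh : Measurable h)
    (c : Finset (Fin n) → ℝ≥0∞) (m : ℕ) :
    ∀ S, Measurable (ringFunctional h c m S) := by
  induction m with
  | zero => intro S; exact measurable_const
  | succ m ih =>
    intro S
    rw [funext fun ω => ringFunctional.eq_2 h c S ω m]
    split_ifs
    · exact measurable_const
    · exact Finset.measurable_sum _ fun v _ => measurable_indicator_ringsFirst v
        (measurable_ringFunctional_step hh ih S v)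

/-- A superharmonic majorant of the terminal values bounds the expectation of the functional. -/
lemma lintegral_ringFunctional_le (G : SimpleGraph (Fin n)) {h : ℝ → ℝ≥0∞} (hh : Measurable h)
    {c b : Finset (Fin n) → ℝ≥0∞} (hcb : ∀ S, c S ≤ b S)
    (hb : ∀ S, S.Nonempty → S ≠ Finset.univ → (∫⁻ x, h x ∂(expMeasure n)) *
      ∑ v, ENNReal.ofReal (1 / n) * ∫⁻ w, b (absorb S v w) ∂(contactLaw G v) ≤ b S) (m : ℕ) :
    ∀ S, S.Nonempty → ∫⁻ ω, ringFunctional h c m S ω ∂(protocolLaw G) ≤ b S := by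
  induction m with
  | zero => intro S _; simpa [ringFunctional] using hcb S
  | succ m ih =>
    intro S hSn
    unfold ringFunctional
    split_ifs with hS
    · simpa using hcb S
    · rw [lintegral_finsetSum _ fun v _ => measurable_indicator_ringsFirst v
        (measurable_ringFunctional_step hh (measurable_ringFunctional hh c m) S v)]
      refine le_trans ?_ (hb S hSn hS)
      rw [Finset.mul_sum]
      refine Finset.sum_le_sum fun v _ => ?_
      rw [lintegral_ringsFirst G v
        (measurable_ringFunctional_step hh (measurable_ringFunctional hh c m) S v),
        mul_left_comm]
      gcongr
      have h1 : ∀ x, ∫⁻ w, ∫⁻ ω, h x * ringFunctional h c m (absorb S v w) ω ∂(protocolLaw G)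
          ∂(contactLaw G v) ≤ h x * ∫⁻ w, b (absorb S v w) ∂(contactLaw G v) := by
        intro x
        rw [← lintegral_const_mul _ (measurable_of_countable _)]
        refine lintegral_mono fun w => ?_
        rw [lintegral_const_mul _ (measurable_ringFunctional hh c m _)]
        gcongr
        exact ih _ (hSn.mono (subset_absorb _ _ _))
      refine (lintegral_mono h1).trans ?_
      rw [lintegral_mul_const _ hh]

lemma RingsFirst.unique {v w : Fin n} {ω : Realization n} (hv : RingsFirst v ω)
    (hw : RingsFirst w ω) : v = w := by
  by_contra h
  exact lt_asymm (hv w (Ne.symm h)) (hw v h)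

lemma RingsFirst.ringFunctional_succ {v : Fin n} {ω : Realization n} (hv : RingsFirst v ω)
    (h : ℝ → ℝ≥0∞) (c : Finset (Fin n) → ℝ≥0∞) (m : ℕ) {S : Finset (Fin n)}
    (hS : S ≠ Finset.univ) :
    ringFunctional h c (m + 1) S ω = h (ω (v, 0)).1 *
        ringFunctional h c m (absorb S v (ω (v, 0)).2) (residual v (ω (v, 0)).1 ω) := by
  rw [ringFunctional, if_neg hS, Finset.sum_eq_single v]
  · exact Set.indicator_of_mem (by exact hv) _
  · intro w _ hw
    exact Set.indicator_of_notMem (fun h : RingsFirst w ω => hw (h.unique hv)) _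
  · simp

open scoped Classical in
/-- After `m` rings, either not all nodes are informed, or the functional with weights
`exp (θ x)` is the exponential of `θ` times the spreading time. -/
lemma ae_ringFunctional_dichotomy [NeZero n] (G : SimpleGraph (Fin n)) (ρ : ℝ≥0∞) (θ : ℝ)
    (m : ℕ) :
    ∀ᵐ ω ∂(protocolLaw G), ∀ S : Finset (Fin n),
      ringFunctional (fun _ => ρ) (fun S => if S = Finset.univ then 0 else 1) m S ω = ρ ^ m ∨
      ∃ Y : ℝ, 0 ≤ Y ∧ (∀ t, (∀ u, InformedFrom ω S u t) ↔ Y ≤ t) ∧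
        ringFunctional (fun x => ENNReal.ofReal (Real.exp (θ * x)))
          (fun S => if S = Finset.univ then 1 else 0) m S ω = ENNReal.ofReal (Real.exp (θ * Y)) := by
  have huniv : ∀ ω : Realization n, PositiveWaits ω → ∀ t,
      (∀ u, InformedFrom ω Finset.univ u t) ↔ 0 ≤ t := by
    intro ω hω t
    exact ⟨fun h => hω.nonneg_of_informedFrom (h 0), fun h u => .start u (Finset.mem_univ u) t h⟩
  induction m with
  | zero =>
    filter_upwards [ae_positiveWaits G] with ω hω S
    by_cases hS : S = Finset.univ
    · right
      subst hS
      exact ⟨0, le_rfl, huniv ω hω, by simp [ringFunctional]⟩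
    · left; simp [ringFunctional, hS]
  | succ m ih =>
    filter_upwards [ae_positiveWaits G, ae_exists_ringsFirst G, ae_residual G ih]
      with ω hω ⟨v, hv⟩ hres S
    by_cases hS : S = Finset.univ
    · right
      subst hS
      exact ⟨0, le_rfl, huniv ω hω, by simp [ringFunctional]⟩
    · rw [hv.ringFunctional_succ _ _ _ hS, hv.ringFunctional_succ _ _ _ hS]
      rcases hres v hv (absorb S v (ω (v, 0)).2) with h | ⟨Y, hY, hiff, hval⟩
      · left; rw [h, pow_succ']
      · right
        refine ⟨(ω (v, 0)).1 + Y, add_nonneg (hω _).le hY, fun t => ?_, ?_⟩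
        · rw [hv.forall_informedFrom_iff hω hS, hiff]
          constructor
          · rintro ⟨_, h⟩; linarith
          · intro h; exact ⟨by linarith, by linarith⟩
        · rw [hval, ← ENNReal.ofReal_mul (Real.exp_pos _).le, ← Real.exp_add, mul_add]

lemma spreadTime_eq_of_forall_iff {s : Fin n} {ω : Realization n} {Y : ℝ}
    (h : ∀ t, (∀ u, InformedFrom ω {s} u t) ↔ Y ≤ t) : spreadTime s ω = ENNReal.ofReal Y := by
  unfold spreadTime
  simp only [informedFrom_singleton_iff] at h
  refine le_antisymm (iInf₂_le Y ((h Y).2 le_rfl)) (le_iInf₂ fun t ht => ?_)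
  exact ENNReal.ofReal_le_ofReal ((h t).1 ht)

open scoped Classical in
/-- If a superharmonic function for the jumps of the informed set decreases by a factor `ρ⁻¹ < 1`
per ring, then all nodes are informed after finitely many rings; the functionals converge. -/
lemma ae_tendsto_ringFunctional [NeZero n] (G : SimpleGraph (Fin n)) (s : Fin n) {ρ : ℝ≥0∞}
    (hρ : 1 < ρ) (hρt : ρ ≠ ∞) {b : Finset (Fin n) → ℝ≥0∞} (hb1 : ∀ S, 1 ≤ b S)
    (hbt : ∀ S, b S ≠ ∞)
    (hb : ∀ S, S.Nonempty → S ≠ Finset.univ → ρ *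
      ∑ v, ENNReal.ofReal (1 / n) * ∫⁻ w, b (absorb S v w) ∂(contactLaw G v) ≤ b S) (θ : ℝ) :
    ∀ᵐ ω ∂(protocolLaw G), spreadTime s ω ≠ ∞ ∧
      Tendsto (fun m => ringFunctional (fun x => ENNReal.ofReal (Real.exp (θ * x)))
          (fun S => if S = Finset.univ then 1 else 0) m {s} ω) atTop
        (𝓝 (ENNReal.ofReal (Real.exp (θ * (spreadTime s ω).toReal)))) := by
  set Q := fun m => ringFunctional (n := n) (fun _ => ρ)
    (fun S => if S = Finset.univ then 0 else 1) m {s} with hQ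
  have hρ0 : ρ ≠ 0 := (zero_lt_one.trans hρ).ne'
  have hn : (0 : ℝ) < n := by exact_mod_cast Nat.pos_of_ne_zero (NeZero.ne n)
  have := isProbabilityMeasure_expMeasure hn
  have hQm : ∀ m, Measurable (Q m) := fun m => measurable_ringFunctional measurable_const _ m _
  have hle : ∀ m, ∫⁻ ω, Q m ω ∂(protocolLaw G) ≤ b {s} := fun m =>
    lintegral_ringFunctional_le G measurable_const
      (fun S => by split_ifs; exacts [zero_le, hb1 S])
      (fun S h1 h2 => by simpa using hb S h1 h2) m _ (Finset.singleton_nonempty s)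
  -- Being unfinished after m rings forces `Q m = ρ ^ m`, while the mean of `Q m` stays below `b
  -- {s}`. Markov's inequality gives geometric decay, as required for Borel–Cantelli.
  have hmeas : ∀ m, protocolLaw G {ω | ρ ^ m ≤ Q m ω} ≤ b {s} * (ρ⁻¹) ^ m := by
    intro m
    refine (meas_ge_le_lintegral_div (hQm m).aemeasurable (pow_ne_zero _ hρ0)
      (ENNReal.pow_ne_top hρt)).trans ?_
    rw [div_eq_mul_inv, ENNReal.inv_pow]
    gcongr
    exact hle m
  have hsum : ∑' m, protocolLaw G {ω | ρ ^ m ≤ Q m ω} ≠ ∞ := by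
    refine ne_top_of_le_ne_top ?_ (ENNReal.tsum_le_tsum hmeas)
    rw [ENNReal.tsum_mul_left, ENNReal.tsum_geometric]
    refine ENNReal.mul_ne_top (hbt _) (ENNReal.inv_ne_top.2 ?_)
    exact (tsub_pos_of_lt (ENNReal.inv_lt_one.2 hρ)).ne'
  have hdich := ae_all_iff.2 fun m => ae_ringFunctional_dichotomy G ρ θ m
  filter_upwards [ae_eventually_notMem hsum, hdich] with ω hω hd
  have hev : ∀ᶠ m in atTop, ∃ Y : ℝ, 0 ≤ Y ∧ (∀ t, (∀ u, InformedFrom ω {s} u t) ↔ Y ≤ t) ∧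
        ringFunctional (fun x => ENNReal.ofReal (Real.exp (θ * x)))
          (fun S => if S = Finset.univ then 1 else 0) m {s} ω =
            ENNReal.ofReal (Real.exp (θ * Y)) := by
    filter_upwards [hω] with m hm
    rcases hd m {s} with h | h
    · exact absurd (by exact h.ge) hm
    · exact h
  constructor
  · obtain ⟨m, Y, hY, hiff, _⟩ := hev.exists
    rw [spreadTime_eq_of_forall_iff hiff]
    exact ENNReal.ofReal_ne_top
  · refine tendsto_const_nhds.congr' ?_
    filter_upwards [hev] with m ⟨Y, hY, hiff, hval⟩
    rw [hval, spreadTime_eq_of_forall_iff hiff, ENNReal.toReal_ofReal hY]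

/-! ### The rate at which the informed set grows -/

open scoped Classical in
/-- The rate at which an informed set `S` grows: the sum over all nodes of the probability that
the node contacts a node on the other side of the cut. -/
noncomputable def growthRate (G : SimpleGraph (Fin n)) (S : Finset (Fin n)) : ℝ :=
  ∑ v, (contactLaw G v).real {w | ¬ (v ∈ S ↔ w ∈ S)}

lemma card_absorb (S : Finset (Fin n)) (v w : Fin n) :
    (absorb S v w).card = if (v ∈ S ↔ w ∈ S) then S.card else S.card + 1 := by
  unfold absorb
  by_cases hv : v ∈ S <;> by_cases hw : w ∈ S <;> simp [hv, hw]

/-- A contact adds one node if it crosses the cut and none otherwise, so only the crossing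
probability enters. -/
lemma lintegral_absorb (G : SimpleGraph (Fin n)) (S : Finset (Fin n)) (v : Fin n)
    {b : ℕ → ℝ} (hb : ∀ k, 0 ≤ b k) :
    ∫⁻ w, ENNReal.ofReal (b (absorb S v w).card) ∂(contactLaw G v) =
      ENNReal.ofReal (b S.card + (b (S.card + 1) - b S.card) *
        (contactLaw G v).real {w | ¬ (v ∈ S ↔ w ∈ S)}) := by
  set A := {w | ¬ (v ∈ S ↔ w ∈ S)} with hA
  have hAm : MeasurableSet A := A.toFinite.measurableSet
  have h1 : ∀ w, ENNReal.ofReal (b (absorb S v w).card) =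
      A.indicator (fun _ => ENNReal.ofReal (b (S.card + 1))) w +
        Aᶜ.indicator (fun _ => ENNReal.ofReal (b S.card)) w := by
    intro w
    rw [card_absorb]
    by_cases h : w ∈ A
    · have h' : ¬ (v ∈ S ↔ w ∈ S) := h
      simp [h, h']
    · have h' : (v ∈ S ↔ w ∈ S) := by simpa [hA] using h
      simp [h, h']
  simp only [h1]
  rw [lintegral_add_left (measurable_const.indicator hAm), lintegral_indicator_const hAm,
    lintegral_indicator_const hAm.compl, ← ofReal_measureReal, ← ofReal_measureReal,
    ← ENNReal.ofReal_mul (hb _), ← ENNReal.ofReal_mul (hb _),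
    ← ENNReal.ofReal_add (by have := hb (S.card + 1); positivity)
      (by have := hb (S.card); positivity), probReal_compl_eq_one_sub hAm]
  congr 1
  ring

/-- The products `∏ l j / (l j - θ)` over `k ≤ j < n`: the exponential moments of a sum of
independent exponential variables with rates `l j`. -/
noncomputable def expMoment (n : ℕ) (l : ℕ → ℝ) (θ : ℝ) (k : ℕ) : ℝ :=
  ∏ j ∈ Finset.Ico k n, l j / (l j - θ)

section

variable {l : ℕ → ℝ} {θ : ℝ}

lemma expMoment_succ {k : ℕ} (hk : k < n) :
    expMoment n l θ k = l k / (l k - θ) * expMoment n l θ (k + 1) :=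
  Finset.prod_eq_prod_Ico_succ_bot hk _

lemma expMoment_pos (hl : ∀ k, 0 < l k) (hθ : ∀ k, θ < l k) (k : ℕ) :
    0 < expMoment n l θ k :=
  Finset.prod_pos fun j _ => div_pos (hl j) (by linarith [hθ j])

/-- The drift of `expMoment` along the jumps of the informed set. -/
lemma sum_lintegral_expMoment_le (G : SimpleGraph (Fin n)) (hl : ∀ k, 0 < l k)
    (hθ : ∀ k, θ < l k)
    {S : Finset (Fin n)} (hS : S ≠ Finset.univ)
    (hrate : 0 ≤ θ * (growthRate G S - l S.card)) :
    ∑ v, ENNReal.ofReal (1 / n) *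
        ∫⁻ w, ENNReal.ofReal (expMoment n l θ (absorb S v w).card) ∂(contactLaw G v) ≤
      ENNReal.ofReal ((1 - θ / n) * expMoment n l θ S.card) := by
  have hk : S.card < n := by
    obtain ⟨x, hx⟩ : ∃ x, x ∉ S := by
      by_contra h; push Not at h; exact hS (Finset.eq_univ_iff_forall.2 h)
    simpa using Finset.card_lt_univ_of_notMem hx
  have hn : (0 : ℝ) < n := by exact_mod_cast Nat.zero_lt_of_lt hk
  have hpos := expMoment_pos (n := n) hl hθ
  simp only [lintegral_absorb G S _ fun k => (hpos k).le]
  set β := expMoment n l θ with hβ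
  have hnn : ∀ v, 0 ≤ β S.card + (β (S.card + 1) - β S.card) *
      (contactLaw G v).real {w | ¬ (v ∈ S ↔ w ∈ S)} := by
    intro v
    have h1 : (contactLaw G v).real {w | ¬ (v ∈ S ↔ w ∈ S)} ≤ 1 := measureReal_le_one
    have h0 : 0 ≤ (contactLaw G v).real {w | ¬ (v ∈ S ↔ w ∈ S)} := measureReal_nonneg
    nlinarith [hpos S.card, hpos (S.card + 1)]
  have h2 : ∀ v, ENNReal.ofReal (1 / n) * ENNReal.ofReal (β S.card +
      (β (S.card + 1) - β S.card) * (contactLaw G v).real {w | ¬ (v ∈ S ↔ w ∈ S)}) =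
      ENNReal.ofReal (1 / n * (β S.card +
      (β (S.card + 1) - β S.card) * (contactLaw G v).real {w | ¬ (v ∈ S ↔ w ∈ S)})) := fun v =>
    (ENNReal.ofReal_mul (by positivity)).symm
  simp only [h2]
  rw [← ENNReal.ofReal_sum_of_nonneg fun v _ => mul_nonneg (by positivity) (hnn v)]
  refine ENNReal.ofReal_le_ofReal ?_
  rw [← Finset.mul_sum, Finset.sum_add_distrib, ← Finset.mul_sum, Finset.sum_const,
    Finset.card_univ, Fintype.card_fin, nsmul_eq_mul]
  have hr : ∑ v, (contactLaw G v).real {w | ¬ (v ∈ S ↔ w ∈ S)} = growthRate G S := rfl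
  rw [hr]
  set g := growthRate G S
  have hs : β S.card = l S.card / (l S.card - θ) * β (S.card + 1) := expMoment_succ hk
  have hd : 0 < l S.card - θ := by linarith [hθ S.card]
  -- Equality holds for `g = l S.card`. The difference of the two sides is θ(g - l) times a
  -- nonnegative factor, which is why one sign condition serves both signs of θ.
  have key : θ * β S.card ≤ g * (β S.card - β (S.card + 1)) := by
    have e1 : β S.card - β (S.card + 1) = θ * (β (S.card + 1) / (l S.card - θ)) := by
      rw [hs]; field_simp; ring
    have e2 : β S.card = l S.card * (β (S.card + 1) / (l S.card - θ)) := by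
      rw [hs]; field_simp
    rw [e1]
    conv_lhs => rw [e2]
    have : 0 ≤ β (S.card + 1) / (l S.card - θ) := div_nonneg (hpos _).le hd.le
    nlinarith [mul_nonneg hrate this]
  have e3 : 1 / (n : ℝ) * (n * β S.card + (β (S.card + 1) - β S.card) * g) =
      β S.card - (g * (β S.card - β (S.card + 1))) / n := by
    field_simp; ring
  have e4 : (1 - θ / n) * β S.card = β S.card - (θ * β S.card) / n := by ring
  rw [e3, e4]
  gcongr

end

/-! ### Exponential moments of the spreading time -/

open scoped Classical in
/-- Under a positive lower bound for the growth rates, the spreading time is almost surely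
finite, it is measurable, and it has the exponential moments that bounds for the growth rates
suggest. -/
theorem spreadTime_exponential_moment (G : SimpleGraph (Fin n)) (s : Fin n)
    {l₀ : ℕ → ℝ} {θ₀ : ℝ} (hθ₀ : 0 < θ₀) (hθ₀n : θ₀ < n) (hl₀ : ∀ k, θ₀ < l₀ k)
    (hrate₀ : ∀ S : Finset (Fin n), S.Nonempty → S ≠ Finset.univ → l₀ S.card ≤ growthRate G S) :
    (∀ᵐ ω ∂(protocolLaw G), spreadTime s ω ≠ ∞) ∧
    AEMeasurable (fun ω => (spreadTime s ω).toReal) (protocolLaw G) ∧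
    ∀ (l : ℕ → ℝ) (θ : ℝ), θ < n → (∀ k, 0 < l k) → (∀ k, θ < l k) →
      (∀ S : Finset (Fin n), S.Nonempty → S ≠ Finset.univ →
        0 ≤ θ * (growthRate G S - l S.card)) →
      ∫⁻ ω, ENNReal.ofReal (Real.exp (θ * (spreadTime s ω).toReal)) ∂(protocolLaw G) ≤
        ENNReal.ofReal (expMoment n l θ 1) := by
  have hn0 : 0 < n := by have := s.2; omega
  have : NeZero n := ⟨hn0.ne'⟩
  have hn : (0 : ℝ) < n := by exact_mod_cast hn0
  have hl₀p : ∀ k, 0 < l₀ k := fun k => hθ₀.trans (hl₀ k)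
  set ρ : ℝ≥0∞ := ENNReal.ofReal (n / (n - θ₀)) with hρ
  -- The exponential moment n/(n-θ) of the waiting time until the next ring exactly cancels the
  -- drift factor 1 - θ/n of the jump.
  have hmul : ∀ {θ : ℝ}, θ < n → ∀ x : ℝ,
      ENNReal.ofReal (n / (n - θ)) * ENNReal.ofReal ((1 - θ / n) * x) = ENNReal.ofReal x := by
    intro θ hθ x
    have : 0 < (n : ℝ) - θ := by linarith
    rw [← ENNReal.ofReal_mul (by positivity)]
    congr 1
    field_simp
  have htend := fun θ => ae_tendsto_ringFunctional G s (ρ := ρ)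
    (b := fun S => ENNReal.ofReal (expMoment n l₀ θ₀ S.card))
    (by
      rw [hρ, ← ENNReal.ofReal_one, ENNReal.ofReal_lt_ofReal_iff_of_nonneg zero_le_one,
        one_lt_div (by linarith)]
      linarith)
    ENNReal.ofReal_ne_top
    (fun S => by
      rw [← ENNReal.ofReal_one]
      refine ENNReal.ofReal_le_ofReal ?_
      unfold expMoment
      refine Finset.prod_induction _ (fun x : ℝ => 1 ≤ x) (fun a b => one_le_mul_of_one_le_of_one_le)
        le_rfl fun j _ => ?_
      rw [le_div_iff₀ (by linarith [hl₀ j])]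
      linarith)
    (fun S => ENNReal.ofReal_ne_top)
    (fun S h1 h2 => by
      refine (mul_le_mul_right (sum_lintegral_expMoment_le G hl₀p hl₀ h2
        (mul_nonneg hθ₀.le (sub_nonneg.2 (hrate₀ S h1 h2)))) _).trans ?_
      rw [hρ, hmul hθ₀n]) θ
  refine ⟨(htend 0).mono fun ω h => h.1, ?_, ?_⟩
  -- The spreading time is an infimum over uncountably many times; its measurability comes from
  -- writing it as the logarithm of an almost sure limit of measurable functionals.
  · have h1 : AEMeasurable (fun ω =>
        ENNReal.ofReal (Real.exp (1 * (spreadTime s ω).toReal))) (protocolLaw G) :=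
      aemeasurable_of_tendsto_metrizable_ae atTop
        (fun m => (measurable_ringFunctional (by fun_prop) _ m _).aemeasurable)
        ((htend 1).mono fun ω h => h.2)
    have h2 := (Real.measurable_log.comp ENNReal.measurable_toReal).comp_aemeasurable h1
    refine h2.congr (ae_of_all _ fun ω => ?_)
    simp [ENNReal.toReal_ofReal (Real.exp_pos _).le]
  · intro l θ hθn hl hθ hrate
    have hF : ∀ m, ∫⁻ ω, ringFunctional (fun x => ENNReal.ofReal (Real.exp (θ * x)))
          (fun S => if S = Finset.univ then 1 else 0) m {s} ω ∂(protocolLaw G) ≤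
        ENNReal.ofReal (expMoment n l θ ({s} : Finset (Fin n)).card) := fun m =>
      lintegral_ringFunctional_le G (by fun_prop)
        (b := fun S => ENNReal.ofReal (expMoment n l θ S.card))
        (fun S => by
          split_ifs with h
          · subst h; simp [expMoment]
          · exact zero_le)
        (fun S h1 h2 => by
          rw [lintegral_ofReal_exp_expMeasure hn hθn]
          refine (mul_le_mul_right (sum_lintegral_expMoment_le G hl hθ h2
            (hrate S h1 h2)) _).trans ?_
          rw [hmul hθn]) m _ (Finset.singleton_nonempty s)
    rw [Finset.card_singleton] at hF
    -- Fatou's lemma: the functionals converge almost surely, and their means share one bound.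
    rw [lintegral_congr_ae ((htend θ).mono fun ω h => h.2.liminf_eq.symm)]
    refine (lintegral_liminf_le fun m => measurable_ringFunctional (by fun_prop) _ m _).trans ?_
    exact liminf_le_of_frequently_le' (Frequently.of_forall hF)

/-! ### Growth rates in graphs with uniform cuts -/

open scoped Classical in
lemma contactLaw_real (G : SimpleGraph (Fin n)) {v : Fin n} (hv : (G.neighborSet v).Nonempty)
    (A : Set (Fin n)) :
    (contactLaw G v).real A =
      ((Finset.univ.filter fun w => G.Adj v w ∧ w ∈ A).card : ℝ) /
        (Finset.univ.filter fun w => G.Adj v w).card := by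
  have h1 : Measure.count (G.neighborSet v) =
      ((Finset.univ.filter fun w => G.Adj v w).card : ℝ≥0∞) := by
    rw [← Measure.count_apply_finset]
    congr 1
    ext w; simp
  have h2 : Measure.count (G.neighborSet v ∩ A) =
      ((Finset.univ.filter fun w => G.Adj v w ∧ w ∈ A).card : ℝ≥0∞) := by
    rw [← Measure.count_apply_finset]
    congr 1
    ext w; simp
  rw [contactLaw, if_pos hv, measureReal_def, uniformOn, cond_apply
    (Set.toFinite _).measurableSet, h1, h2]
  simp [div_eq_inv_mul]

-- Every cut edge is counted from both of its ends, since it carries the rumor by a push from one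
-- end and a pull from the other. This is the factor 2 in the growth rate.
open scoped Classical in
lemma sum_card_adj_cut (G : SimpleGraph (Fin n)) (S : Finset (Fin n)) :
    ∑ v, (Finset.univ.filter fun w => G.Adj v w ∧ w ∈ {w | ¬ (v ∈ S ↔ w ∈ S)}).card =
      2 * (G.interedges S Sᶜ).card := by
  have h1 : ∀ A B : Finset (Fin n), ∑ v ∈ A, (Finset.univ.filter fun w => G.Adj v w ∧ w ∈ B).card =
      (G.interedges A B).card := by
    intro A B
    rw [SimpleGraph.interedges, Rel.interedges, Finset.card_filter, Finset.sum_product]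
    refine Finset.sum_congr rfl fun v _ => ?_
    rw [← Finset.card_filter]
    congr 1
    ext w
    simp [and_comm]
  rw [← Finset.sum_add_sum_compl S, two_mul]
  have := G.symm
  have h2 : (G.interedges S Sᶜ).card = (G.interedges Sᶜ S).card :=
    Rel.card_interedges_comm S Sᶜ
  conv_rhs => enter [2]; rw [h2]
  rw [← h1 S Sᶜ, ← h1 Sᶜ S]
  congr 1
  · refine Finset.sum_congr rfl fun v hv => ?_
    congr 1; ext w; simp [hv]
  · refine Finset.sum_congr rfl fun v hv => ?_
    have hv' : v ∉ S := by simpa using hv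
    congr 1; ext w; simp [hv']

open scoped Classical in
lemma card_interedges_singleton (G : SimpleGraph (Fin n)) (v : Fin n) :
    (G.interedges {v} {v}ᶜ).card = (Finset.univ.filter fun w => G.Adj v w).card := by
  rw [SimpleGraph.interedges, Rel.interedges, Finset.card_filter, Finset.sum_product,
    Finset.sum_singleton, ← Finset.card_filter]
  congr 1
  ext w
  simp only [Finset.mem_filter, Finset.mem_compl, Finset.mem_singleton, Finset.mem_univ,
    true_and, and_iff_right_iff_imp]
  rintro h rfl
  exact G.loopless.irrefl _ h

/-- In a graph with uniform cuts the growth rates are, up to a constant factor, those of the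
complete graph. -/
lemma UniformCuts.growthRate_mem {G : SimpleGraph (Fin n)} {a : ℝ} (h : UniformCuts G a)
    (ha : 0 < a) (hε : √(8 / a) < 1) (hn : 2 ≤ n) (S : Finset (Fin n)) :
    (1 - √(8 / a)) / (1 + √(8 / a)) * (2 * S.card * (n - S.card) / (n - 1)) ≤ growthRate G S ∧
    growthRate G S ≤
      (1 + √(8 / a)) / (1 - √(8 / a)) * (2 * S.card * (n - S.card) / (n - 1)) := by
  classical
  set ε := √(8 / a) with hεdef
  have hε0 : 0 ≤ ε := Real.sqrt_nonneg _
  have hn2 : (2 : ℝ) ≤ n := by exact_mod_cast hn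
  have hlog : 0 < Real.log n := Real.log_pos (by linarith)
  set q := a * Real.log n / n with hq
  have hq0 : 0 < q := by positivity
  have hn1 : (0 : ℝ) < n - 1 := by linarith
  have hD : 0 < q * (n - 1) := by positivity
  have hcut : ∀ S : Finset (Fin n), (1 - ε) * (q * S.card * (n - S.card)) ≤
      ((G.interedges S Sᶜ).card : ℝ) ∧ ((G.interedges S Sᶜ).card : ℝ) ≤
      (1 + ε) * (q * S.card * (n - S.card)) := by
    intro S
    have h1 := h S
    have h2 : |((G.interedges S Sᶜ).card : ℝ) - q * S.card * (n - S.card)| ≤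
        ε * (q * S.card * (n - S.card)) := by convert h1
    rw [abs_le] at h2
    constructor <;> linarith [h2.1, h2.2]
  set d : Fin n → ℝ := fun v => (Finset.univ.filter fun w => G.Adj v w).card with hd
  -- The degree of `v` is the size of the cut around `{v}`.
  have hdeg : ∀ v, (1 - ε) * (q * (n - 1)) ≤ d v ∧ d v ≤ (1 + ε) * (q * (n - 1)) := by
    intro v
    have h1 := hcut {v}
    rw [card_interedges_singleton] at h1
    simpa using h1
  have hlow : 0 < (1 - ε) * (q * (n - 1)) := mul_pos (by linarith) hD
  have hdpos : ∀ v, 0 < d v := fun v => hlow.trans_le (hdeg v).1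
  have hne : ∀ v, (G.neighborSet v).Nonempty := by
    intro v
    have h1 := hdpos v
    simp only [hd, Nat.cast_pos, Finset.card_pos] at h1
    obtain ⟨w, hw⟩ := h1
    exact ⟨w, by simpa using hw⟩
  have hg : growthRate G S = ∑ v, ((Finset.univ.filter fun w => G.Adj v w ∧
      w ∈ {w | ¬ (v ∈ S ↔ w ∈ S)}).card : ℝ) / d v :=
    Finset.sum_congr rfl fun v _ => by rw [contactLaw_real G (hne v)]; congr!
  have hsum : ∑ v, ((Finset.univ.filter fun w => G.Adj v w ∧
      w ∈ {w | ¬ (v ∈ S ↔ w ∈ S)}).card : ℝ) = 2 * (G.interedges S Sᶜ).card := by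
    exact_mod_cast sum_card_adj_cut G S
  rw [hg]
  constructor
  · calc _ = 2 * ((1 - ε) * (q * S.card * (n - S.card))) / ((1 + ε) * (q * (n - 1))) := by
          field_simp
      _ ≤ 2 * (G.interedges S Sᶜ).card / ((1 + ε) * (q * (n - 1))) := by
          have := (hcut S).1
          gcongr
      _ ≤ _ := by
          rw [← hsum, Finset.sum_div]
          refine Finset.sum_le_sum fun v _ => ?_
          have := hdpos v
          have := (hdeg v).2
          gcongr
  · calc _ ≤ 2 * (G.interedges S Sᶜ).card / ((1 - ε) * (q * (n - 1))) := by
          rw [← hsum, Finset.sum_div]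
          refine Finset.sum_le_sum fun v _ => ?_
          have := (hdeg v).1
          gcongr
      _ ≤ 2 * ((1 + ε) * (q * S.card * (n - S.card))) / ((1 - ε) * (q * (n - 1))) := by
          have := (hcut S).2
          gcongr
      _ = _ := by
          have : 1 - ε ≠ 0 := by linarith
          field_simp

/-! ### Estimates for exponential moments -/

/-- For x ≤ 0 the bound exp y ≥ 1 + y suffices, because (1-x)(1+x+x²) = 1 - x³ ≥ 1. For x ≥ 0 the
quadratic term of the exponential is needed. -/
lemma inv_one_sub_le_exp {x : ℝ} (hx : |x| ≤ 1 / 2) : 1 / (1 - x) ≤ Real.exp (x + x ^ 2) := by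
  rw [abs_le] at hx
  have h1 : 0 < 1 - x := by linarith [hx.2]
  rw [div_le_iff₀ h1]
  rcases le_total 0 x with h | h
  · have h2 := Real.quadratic_le_exp_of_nonneg (x := x + x ^ 2) (by positivity)
    have h3 : 0 ≤ x ^ 2 * (1 / 2 - 1 / 2 * x - x ^ 2) := by
      have : 0 ≤ 1 / 2 - 1 / 2 * x - x ^ 2 := by nlinarith [hx.2]
      positivity
    have h4 : 0 ≤ x ^ 4 * (1 - x) := by positivity
    nlinarith [mul_le_mul_of_nonneg_right h2 h1.le]
  · have h2 := Real.add_one_le_exp (x + x ^ 2)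
    have h3 : 0 ≤ (-x) ^ 3 := pow_nonneg (by linarith) 3
    nlinarith [mul_le_mul_of_nonneg_right h2 h1.le]

lemma expMoment_le_exp {l : ℕ → ℝ} {θ : ℝ} {k : ℕ} (hl : ∀ j ∈ Finset.Ico k n, 0 < l j)
    (hθ : ∀ j ∈ Finset.Ico k n, |θ| ≤ l j / 2) :
    expMoment n l θ k ≤
      Real.exp (θ * ∑ j ∈ Finset.Ico k n, 1 / l j + θ ^ 2 * ∑ j ∈ Finset.Ico k n, (1 / l j) ^ 2) := by
  rw [Finset.mul_sum, Finset.mul_sum, ← Finset.sum_add_distrib, Real.exp_sum]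
  have hx : ∀ j ∈ Finset.Ico k n, |θ / l j| ≤ 1 / 2 := by
    intro j hj
    have h1 := hl j hj
    have h2 := hθ j hj
    rw [abs_div, abs_of_pos h1, div_le_iff₀ h1]
    linarith
  have heq : ∀ j ∈ Finset.Ico k n, l j / (l j - θ) = 1 / (1 - θ / l j) := by
    intro j hj
    have h1 := hl j hj
    field_simp
  refine Finset.prod_le_prod (fun j hj => ?_) fun j hj => ?_
  · rw [heq j hj]
    have := (abs_le.1 (hx j hj)).2
    exact div_nonneg zero_le_one (by linarith)
  · rw [heq j hj]
    refine (inv_one_sub_le_exp (hx j hj)).trans (Real.exp_le_exp.2 (le_of_eq ?_))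
    ring

/-- The rate at which an informed set of size `k` grows in the complete graph. -/
noncomputable def completeRate (n k : ℕ) : ℝ := 2 * k * (n - k) / (n - 1)

/-- Partial fractions; under the reflection k ↦ n - k both terms have the same sum, which produces
the harmonic number. -/
lemma inv_completeRate {k : ℕ} (hk : k ∈ Finset.Ico 1 n) :
    1 / completeRate n k = (n - 1) / (2 * n) * (1 / k + 1 / ((n - k : ℕ) : ℝ)) := by
  rw [Finset.mem_Ico] at hk
  have h1 : (1 : ℝ) ≤ k := by exact_mod_cast hk.1
  have h2 : (0 : ℝ) < n - k := by have : (k : ℝ) < n := by exact_mod_cast hk.2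
                                  linarith
  have h3 : (0 : ℝ) < n - 1 := by linarith
  have h4 : (0 : ℝ) < n := by linarith
  rw [completeRate, Nat.cast_sub hk.2.le]
  field_simp
  ring

lemma sum_Ico_reflect_sub (f : ℕ → ℝ) :
    ∑ k ∈ Finset.Ico 1 n, f (n - k) = ∑ k ∈ Finset.Ico 1 n, f k := by
  refine Finset.sum_bij' (fun k _ => n - k) (fun k _ => n - k) ?_ ?_ ?_ ?_ ?_ <;>
    intro k hk <;> simp only [Finset.mem_Ico] at * <;> omega

lemma sum_inv_completeRate (hn : 1 ≤ n) :
    ∑ k ∈ Finset.Ico 1 n, 1 / completeRate n k = (n - 1) / n * (harmonic (n - 1) : ℝ) := by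
  rw [Finset.sum_congr rfl fun k hk => inv_completeRate hk, ← Finset.mul_sum,
    Finset.sum_add_distrib, sum_Ico_reflect_sub fun k => 1 / (k : ℝ)]
  have h : (harmonic (n - 1) : ℝ) = ∑ k ∈ Finset.Ico 1 n, 1 / (k : ℝ) := by
    rw [harmonic_eq_sum_Icc]
    push_cast
    have : Finset.Icc 1 (n - 1) = Finset.Ico 1 n := by
      ext k; simp only [Finset.mem_Icc, Finset.mem_Ico]; omega
    rw [this]
    simp
  rw [h]
  have : (n : ℝ) ≠ 0 := by positivity
  field_simp
  ring

lemma one_le_completeRate {k : ℕ} (hk : k ∈ Finset.Ico 1 n) : 1 ≤ completeRate n k := by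
  rw [Finset.mem_Ico] at hk
  have h1 : (1 : ℝ) ≤ k := by exact_mod_cast hk.1
  have h2 : (k : ℝ) + 1 ≤ n := by exact_mod_cast hk.2
  rw [completeRate, le_div_iff₀ (by linarith)]
  nlinarith [mul_nonneg (sub_nonneg.2 h1) (by linarith : (0 : ℝ) ≤ n - k - 1)]

lemma sum_inv_sq_Ico_le (n : ℕ) : ∑ k ∈ Finset.Ico 1 n, (1 / (k : ℝ)) ^ 2 ≤ 2 := by
  have h : ∀ m : ℕ, 1 ≤ m → ∑ k ∈ Finset.Ico 1 (m + 1), (1 / (k : ℝ)) ^ 2 ≤ 2 - 1 / (m : ℝ) := by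
    intro m hm
    induction m, hm using Nat.le_induction with
    | base => norm_num
    | succ m hm ih =>
      rw [Finset.sum_Ico_succ_top (by omega)]
      have hm' : (0 : ℝ) < m := by exact_mod_cast hm
      have h2 : (1 / ((m + 1 : ℕ) : ℝ)) ^ 2 ≤ 1 / m - 1 / ((m + 1 : ℕ) : ℝ) := by
        push_cast
        rw [div_sub_div _ _ (by positivity) (by positivity), div_pow,
          div_le_div_iff₀ (by positivity) (by positivity)]
        nlinarith
      linarith
  rcases Nat.lt_or_ge n 2 with h2 | h2
  · have : Finset.Ico 1 n = ∅ := Finset.Ico_eq_empty (by omega)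
    simp [this]
  · obtain ⟨m, rfl⟩ : ∃ m, n = m + 1 := ⟨n - 1, by omega⟩
    have := h m (by omega)
    have h3 : (0 : ℝ) ≤ 1 / (m : ℝ) := by positivity
    linarith

/-- This plays the role of a bounded variance, so that the tails of the spreading time are
independent of n. -/
lemma sum_inv_sq_completeRate_le (hn : 1 ≤ n) :
    ∑ k ∈ Finset.Ico 1 n, (1 / completeRate n k) ^ 2 ≤ 4 := by
  have h1 : ∀ k ∈ Finset.Ico 1 n, (1 / completeRate n k) ^ 2 ≤
      (1 / (k : ℝ)) ^ 2 + (1 / ((n - k : ℕ) : ℝ)) ^ 2 := by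
    intro k hk
    rw [inv_completeRate hk]
    have hn' : (1 : ℝ) ≤ n := by exact_mod_cast hn
    have hc : ((n : ℝ) - 1) / (2 * n) ≤ 1 / 2 := by
      rw [div_le_div_iff₀ (by positivity) (by norm_num)]; linarith
    have hc0 : 0 ≤ ((n : ℝ) - 1) / (2 * n) := div_nonneg (by linarith) (by positivity)
    set x := 1 / (k : ℝ)
    set y := 1 / ((n - k : ℕ) : ℝ)
    calc _ = (((n : ℝ) - 1) / (2 * n)) ^ 2 * (x + y) ^ 2 := by ring
      _ ≤ (1 / 2) ^ 2 * (x + y) ^ 2 := by gcongr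
      _ ≤ _ := by nlinarith [sq_nonneg (x - y), sq_nonneg (x + y)]
  refine (Finset.sum_le_sum h1).trans ?_
  rw [Finset.sum_add_distrib, sum_Ico_reflect_sub fun k => (1 / (k : ℝ)) ^ 2]
  linarith [sum_inv_sq_Ico_le n]

/-- A random variable whose exponential moments are at most `exp (θ A + 16 θ²)` for small `θ` has
mean at most `A`. -/
lemma integral_le_of_exp_moment {Ω : Type*} [MeasurableSpace Ω] {μ : Measure Ω}
    [IsProbabilityMeasure μ] {X : Ω → ℝ} (hX : Integrable X μ) {A : ℝ}
    (h : ∀ θ, 0 < θ → θ ≤ 1 / 4 → ∫⁻ ω, ENNReal.ofReal (Real.exp (θ * X ω)) ∂μ ≤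
      ENNReal.ofReal (Real.exp (θ * A + 16 * θ ^ 2))) : ∫ ω, X ω ∂μ ≤ A := by
  have hstep : ∀ θ, 0 < θ → θ ≤ 1 / 4 → ∫ ω, X ω ∂μ ≤ A + 32 * θ := by
    intro θ h0 h1
    have hm : AEStronglyMeasurable (fun ω => Real.exp (θ * X ω)) μ :=
      (Real.continuous_exp.comp (continuous_const.mul continuous_id)).comp_aestronglyMeasurable
        hX.aestronglyMeasurable
    have hint : Integrable (fun ω => Real.exp (θ * X ω)) μ := by
      refine ⟨hm, ?_⟩
      rw [hasFiniteIntegral_iff_ofReal (ae_of_all _ fun ω => (Real.exp_pos _).le)]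
      exact (h θ h0 h1).trans_lt ENNReal.ofReal_lt_top
    have hI : ∫ ω, Real.exp (θ * X ω) ∂μ ≤ Real.exp (θ * A + 16 * θ ^ 2) := by
      rw [integral_eq_lintegral_of_nonneg_ae (ae_of_all _ fun ω => (Real.exp_pos _).le) hm]
      exact ENNReal.toReal_le_of_le_ofReal (Real.exp_pos _).le (h θ h0 h1)
    -- The inequality 1 + u ≤ exp u for u = θ(X - A), integrated; dividing by θ leaves an error of
    -- order θ.
    have hlin : ∫ ω, (θ * X ω + (1 - θ * A)) ∂μ ≤
        ∫ ω, Real.exp (-(θ * A)) * Real.exp (θ * X ω) ∂μ := by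
      refine integral_mono ((hX.const_mul θ).add (integrable_const _))
        (hint.const_mul _) fun ω => ?_
      dsimp only
      rw [← Real.exp_add]
      linarith [Real.add_one_le_exp (-(θ * A) + θ * X ω)]
    rw [integral_add (hX.const_mul θ) (integrable_const _), integral_const_mul,
      integral_const_mul] at hlin
    simp only [integral_const, probReal_univ, one_smul] at hlin
    have h3 : Real.exp (-(θ * A)) * ∫ ω, Real.exp (θ * X ω) ∂μ ≤ Real.exp (16 * θ ^ 2) := by
      refine (mul_le_mul_of_nonneg_left hI (Real.exp_pos _).le).trans (le_of_eq ?_)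
      rw [← Real.exp_add]; congr 1; ring
    have h4 : Real.exp (16 * θ ^ 2) ≤ 1 + 32 * θ ^ 2 := by
      have hx : |16 * θ ^ 2| ≤ 1 := by
        rw [abs_of_nonneg (by positivity)]; nlinarith
      have := abs_le.1 (Real.abs_exp_sub_one_le hx)
      rw [abs_of_nonneg (by positivity : (0 : ℝ) ≤ 16 * θ ^ 2)] at this
      linarith [this.2]
    have h5 : θ * (∫ ω, X ω ∂μ - A) ≤ θ * (32 * θ) := by nlinarith
    have := le_of_mul_le_mul_left h5 h0
    linarith
  refine le_of_forall_pos_le_add fun e he => ?_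
  have hmin : 0 < min (1 / 4) (e / 32) := by positivity
  have h1 := hstep _ hmin (min_le_left _ _)
  have h2 := min_le_right (1 / 4 : ℝ) (e / 32)
  linarith

/-- Markov's inequality for exp(X/4); the 1 in the exponent is 16 · (1/4)². -/
lemma measure_ge_le_of_exp_moment {Ω : Type*} [MeasurableSpace Ω] {μ : Measure Ω}
    {X : Ω → ℝ} (hX : AEMeasurable X μ) {A : ℝ}
    (h : ∫⁻ ω, ENNReal.ofReal (Real.exp (1 / 4 * X ω)) ∂μ ≤
      ENNReal.ofReal (Real.exp (1 / 4 * A + 16 * (1 / 4) ^ 2))) (x : ℝ) :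
    μ {ω | A + x ≤ X ω} ≤ ENNReal.ofReal (Real.exp (1 - x / 4)) := by
  have hm : AEMeasurable (fun ω => ENNReal.ofReal (Real.exp (1 / 4 * X ω))) μ :=
    (by fun_prop : Measurable fun y : ℝ =>
      ENNReal.ofReal (Real.exp (1 / 4 * y))).comp_aemeasurable hX
  have h1 := meas_ge_le_lintegral_div hm (ε := ENNReal.ofReal (Real.exp (1 / 4 * (A + x))))
    (by simp [Real.exp_pos]) ENNReal.ofReal_ne_top
  have hset : {ω | A + x ≤ X ω} = {ω | ENNReal.ofReal (Real.exp (1 / 4 * (A + x))) ≤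
      ENNReal.ofReal (Real.exp (1 / 4 * X ω))} := by
    ext ω
    simp only [Set.mem_ofPred_eq]
    rw [ENNReal.ofReal_le_ofReal_iff (Real.exp_pos _).le, Real.exp_le_exp]
    constructor <;> intro h <;> linarith
  rw [hset]
  refine (h1.trans (ENNReal.div_le_div_right h _)).trans (le_of_eq ?_)
  rw [← ENNReal.ofReal_div_of_pos (Real.exp_pos _), ← Real.exp_sub]
  congr 2
  ring

/-! ### Mean and concentration of the spreading time -/

/-- Exponential moments of the spreading time of a graph whose growth rates are within a factor
`r` of those of the complete graph. -/
lemma spreadTime_exp_moment_of_growthRate {G : SimpleGraph (Fin n)} {r : ℝ} (hr : 1 / 2 ≤ r)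
    (hr1 : r ≤ 1) (hn : 2 ≤ n)
    (hlow : ∀ S, r * completeRate n S.card ≤ growthRate G S)
    (hupp : ∀ S, growthRate G S ≤ r⁻¹ * completeRate n S.card) (s : Fin n) :
    (∀ᵐ ω ∂(protocolLaw G), spreadTime s ω ≠ ∞) ∧
    AEMeasurable (fun ω => (spreadTime s ω).toReal) (protocolLaw G) ∧
    (∀ θ, 0 < θ → θ ≤ 1 / 4 →
      ∫⁻ ω, ENNReal.ofReal (Real.exp (θ * (spreadTime s ω).toReal)) ∂(protocolLaw G) ≤
        ENNReal.ofReal (Real.exp (θ * (r⁻¹ * ((n - 1) / n * (harmonic (n - 1) : ℝ))) +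
          16 * θ ^ 2))) ∧
    (∀ θ, 0 < θ → θ ≤ 1 / 4 →
      ∫⁻ ω, ENNReal.ofReal (Real.exp (θ * -(spreadTime s ω).toReal)) ∂(protocolLaw G) ≤
        ENNReal.ofReal (Real.exp (θ * -(r * ((n - 1) / n * (harmonic (n - 1) : ℝ))) +
          16 * θ ^ 2))) := by
  have hr0 : 0 < r := by linarith
  have hri : 1 ≤ r⁻¹ := (one_le_inv₀ hr0).2 hr1
  have hri2 : r⁻¹ ≤ 2 := by rw [inv_le_comm₀ hr0 (by norm_num)]; linarith
  have hn2 : (2 : ℝ) ≤ n := by exact_mod_cast hn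
  -- The complete rate vanishes at k = 0 and k = n; the value 1 outside the relevant sizes only
  -- keeps all rates at least 1/2, hence at least twice any |θ| ≤ 1/4.
  set lo : ℕ → ℝ := fun k => if k ∈ Finset.Ico 1 n then r * completeRate n k else 1 with hlo
  set up : ℕ → ℝ := fun k => if k ∈ Finset.Ico 1 n then r⁻¹ * completeRate n k else 1 with hup
  have hlo1 : ∀ k, 1 / 2 ≤ lo k := by
    intro k
    simp only [hlo]
    split_ifs with hk
    · nlinarith [one_le_completeRate hk]
    · norm_num
  have hup1 : ∀ k, 1 / 2 ≤ up k := by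
    intro k
    simp only [hup]
    split_ifs with hk
    · nlinarith [one_le_completeRate hk]
    · norm_num
  have hcard : ∀ S : Finset (Fin n), S.Nonempty → S ≠ Finset.univ →
      S.card ∈ Finset.Ico 1 n := by
    intro S h1 h2
    rw [Finset.mem_Ico]
    refine ⟨h1.card_pos, ?_⟩
    have := (Finset.card_lt_iff_ne_univ S).2 h2
    simpa using this
  have hlo2 : ∀ S : Finset (Fin n), S.Nonempty → S ≠ Finset.univ → lo S.card ≤ growthRate G S := by
    intro S h1 h2
    simp only [hlo, hcard S h1 h2, if_true]
    exact hlow S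
  have hup2 : ∀ S : Finset (Fin n), S.Nonempty → S ≠ Finset.univ → growthRate G S ≤ up S.card := by
    intro S h1 h2
    simp only [hup, hcard S h1 h2, if_true]
    exact hupp S
  have hsum : ∀ (l : ℕ → ℝ) (c : ℝ), 0 < c → (∀ k ∈ Finset.Ico 1 n, l k = c * completeRate n k) →
      ∑ k ∈ Finset.Ico 1 n, 1 / l k = c⁻¹ * ((n - 1) / n * (harmonic (n - 1) : ℝ)) ∧
      ∑ k ∈ Finset.Ico 1 n, (1 / l k) ^ 2 ≤ (c⁻¹) ^ 2 * 4 := by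
    intro l c hc hl
    have h1 : ∀ k ∈ Finset.Ico 1 n, 1 / l k = c⁻¹ * (1 / completeRate n k) := by
      intro k hk
      rw [hl k hk, one_div, mul_inv, one_div]
    constructor
    · rw [Finset.sum_congr rfl h1, ← Finset.mul_sum, sum_inv_completeRate (by omega)]
    · rw [Finset.sum_congr rfl fun k hk => by rw [h1 k hk, mul_pow], ← Finset.mul_sum]
      gcongr
      exact sum_inv_sq_completeRate_le (by omega)
  obtain ⟨hS1, hQ1⟩ := hsum lo r hr0 fun k hk => by simp only [hlo, hk, if_true]
  obtain ⟨hS2, hQ2⟩ := hsum up r⁻¹ (by linarith) fun k hk => by simp only [hup, hk, if_true]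
  rw [inv_inv] at hS2 hQ2
  obtain ⟨hfin, hmeas, hmom⟩ := spreadTime_exponential_moment G s (l₀ := lo) (θ₀ := 1 / 4)
    (by norm_num) (by linarith) (fun k => by linarith [hlo1 k]) hlo2
  refine ⟨hfin, hmeas, fun θ h0 h1 => ?_, fun θ h0 h1 => ?_⟩
  · refine (hmom lo θ (by linarith) (fun k => by linarith [hlo1 k])
      (fun k => by linarith [hlo1 k])
      fun S hS hS' => mul_nonneg h0.le (sub_nonneg.2 (hlo2 S hS hS'))).trans ?_
    refine ENNReal.ofReal_le_ofReal ((expMoment_le_exp (fun k _ => by linarith [hlo1 k])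
      fun k _ => ?_).trans (Real.exp_le_exp.2 ?_))
    · rw [abs_of_pos h0]; linarith [hlo1 k]
    · rw [hS1]
      have : ∑ k ∈ Finset.Ico 1 n, (1 / lo k) ^ 2 ≤ 16 := hQ1.trans (by nlinarith)
      nlinarith [sq_nonneg θ]
  · have hneg := hmom up (-θ) (by linarith) (fun k => by linarith [hup1 k])
      (fun k => by linarith [hup1 k])
      fun S hS hS' => by nlinarith [hup2 S hS hS']
    simp only [neg_mul] at hneg
    simp only [mul_neg]
    refine hneg.trans ?_
    refine ENNReal.ofReal_le_ofReal ((expMoment_le_exp (fun k _ => by linarith [hup1 k])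
      fun k _ => ?_).trans (Real.exp_le_exp.2 ?_))
    · rw [abs_neg, abs_of_pos h0]; linarith [hup1 k]
    · rw [hS2]
      have : ∑ k ∈ Finset.Ico 1 n, (1 / up k) ^ 2 ≤ 16 := hQ2.trans (by nlinarith)
      nlinarith [sq_nonneg θ]

/-- Mean and tails of the spreading time of a graph whose growth rates are within a factor
`r` of those of the complete graph. -/
lemma spreadTime_mean_and_tail {G : SimpleGraph (Fin n)} {r : ℝ} (hr : 1 / 2 ≤ r)
    (hr1 : r ≤ 1) (hn : 2 ≤ n)
    (hlow : ∀ S, r * completeRate n S.card ≤ growthRate G S)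
    (hupp : ∀ S, growthRate G S ≤ r⁻¹ * completeRate n S.card) (s : Fin n) :
    meanSpreadTime G s ≠ ∞ ∧
    r * ((n - 1) / n * (harmonic (n - 1) : ℝ)) ≤ (meanSpreadTime G s).toReal ∧
    (meanSpreadTime G s).toReal ≤ r⁻¹ * ((n - 1) / n * (harmonic (n - 1) : ℝ)) ∧
    ∀ x : ℝ, protocolLaw G {ω | ¬ (spreadTime s ω ≠ ∞ ∧
        r * ((n - 1) / n * (harmonic (n - 1) : ℝ)) - x < (spreadTime s ω).toReal ∧
        (spreadTime s ω).toReal < r⁻¹ * ((n - 1) / n * (harmonic (n - 1) : ℝ)) + x)} ≤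
      2 * ENNReal.ofReal (Real.exp (1 - x / 4)) := by
  obtain ⟨hfin, hmeas, hpos, hneg⟩ :=
    spreadTime_exp_moment_of_growthRate hr hr1 hn hlow hupp s
  set A := (n - 1) / n * (harmonic (n - 1) : ℝ)
  set T : Realization n → ℝ := fun ω => (spreadTime s ω).toReal with hT
  have hTeq : meanSpreadTime G s = ∫⁻ ω, ENNReal.ofReal (T ω) ∂(protocolLaw G) := by
    refine lintegral_congr_ae (hfin.mono fun ω hω => ?_)
    exact (ENNReal.ofReal_toReal hω).symm
  have hTfin : meanSpreadTime G s ≠ ∞ := by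
    rw [hTeq]
    -- Finiteness of the mean from x ≤ 4 exp(x/4).
    refine ne_top_of_le_ne_top ?_ (lintegral_mono (g := fun ω => ENNReal.ofReal 4 *
      ENNReal.ofReal (Real.exp (1 / 4 * T ω))) fun ω => ?_)
    · rw [lintegral_const_mul' _ _ ENNReal.ofReal_ne_top]
      exact ENNReal.mul_ne_top ENNReal.ofReal_ne_top
        (ne_top_of_le_ne_top ENNReal.ofReal_ne_top (hpos (1 / 4) (by norm_num) le_rfl))
    · dsimp only
      rw [← ENNReal.ofReal_mul (by norm_num)]
      refine ENNReal.ofReal_le_ofReal ?_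
      linarith [Real.add_one_le_exp (1 / 4 * T ω)]
  have hTint : Integrable T (protocolLaw G) := by
    refine ⟨hmeas.aestronglyMeasurable, ?_⟩
    rw [hasFiniteIntegral_iff_ofReal (ae_of_all _ fun ω => ENNReal.toReal_nonneg), ← hTeq]
    exact hTfin.lt_top
  have hmean : (meanSpreadTime G s).toReal = ∫ ω, T ω ∂(protocolLaw G) := by
    rw [integral_eq_lintegral_of_nonneg_ae (ae_of_all _ fun ω => ENNReal.toReal_nonneg)
      hTint.aestronglyMeasurable, hTeq]
  refine ⟨hTfin, ?_, ?_, fun x => ?_⟩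
  · have h := integral_le_of_exp_moment hTint.neg (A := -(r * A)) hneg
    have h2 : ∫ ω, (-T) ω ∂(protocolLaw G) = -∫ ω, T ω ∂(protocolLaw G) := integral_neg T
    rw [hmean]
    linarith
  · rw [hmean]
    exact integral_le_of_exp_moment hTint hpos
  · have h1 := measure_ge_le_of_exp_moment hmeas (hpos (1 / 4) (by norm_num) le_rfl) x
    have h2 := measure_ge_le_of_exp_moment hmeas.neg (A := -(r * A))
      (hneg (1 / 4) (by norm_num) le_rfl) x
    have hsub : {ω | ¬ (spreadTime s ω ≠ ∞ ∧ r * A - x < (spreadTime s ω).toReal ∧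
        (spreadTime s ω).toReal < r⁻¹ * A + x)} ⊆
        {ω | ¬ spreadTime s ω ≠ ∞} ∪ ({ω | r⁻¹ * A + x ≤ T ω} ∪
          {ω | -(r * A) + x ≤ (-T) ω}) := by
      intro ω hω
      by_contra hcon
      simp only [Set.mem_union, Set.mem_ofPred_eq, not_or, not_le, not_not, Pi.neg_apply] at hcon
      refine hω ⟨hcon.1, ?_, hcon.2.1⟩
      have := hcon.2.2
      simp only [hT] at this
      linarith
    refine (measure_mono hsub).trans ((measure_union_le _ _).trans ?_)
    rw [show protocolLaw G {ω | ¬ spreadTime s ω ≠ ∞} = 0 from hfin, zero_add, two_mul]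
    exact (measure_union_le _ _).trans (add_le_add h1 h2)

/-! ### Cuts of binomial random graphs -/

/-- There are finitely many graphs, so with this every function of the graph is measurable. -/
instance : MeasurableSingletonClass (SimpleGraph (Fin n)) where
  measurableSet_singleton G := by
    refine ⟨{G.Adj}, measurableSet_singleton _, ?_⟩
    ext H
    simp

open scoped Classical in
lemma card_interedges_compl (G : SimpleGraph (Fin n)) (S : Finset (Fin n)) :
    (G.interedges Sᶜ Sᶜᶜ).card = (G.interedges S Sᶜ).card := by
  have := G.symm
  rw [compl_compl]
  exact Rel.card_interedges_comm Sᶜ S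

-- Each unordered pair across the cut has exactly one orientation from `S` to its complement, so the
-- count of edges factors over distinct pairs and independence applies.
open scoped Classical in
lemma exp_card_interedges (G : SimpleGraph (Fin n)) (S : Finset (Fin n)) (t : ℝ) :
    ENNReal.ofReal (Real.exp (t * (G.interedges S Sᶜ).card)) =
      ∏ e ∈ (S ×ˢ Sᶜ).image (fun z => s(z.1, z.2)),
        if e ∈ G.edgeSet then ENNReal.ofReal (Real.exp t) else 1 := by
  rw [Finset.prod_image, Finset.prod_ite, Finset.prod_const_one, mul_one, Finset.prod_const,
    ← ENNReal.ofReal_pow (Real.exp_pos _).le, ← Real.exp_nat_mul, mul_comm]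
  · rfl
  · rintro ⟨a, b⟩ hab ⟨c, d⟩ hcd h
    simp only [Finset.coe_product, Set.mem_prod, Finset.mem_coe, Finset.mem_compl] at hab hcd
    rcases Sym2.eq_iff.1 h with h | h
    · exact Prod.ext h.1 h.2
    · dsimp only at h
      exact absurd (h.1 ▸ hab.1) hcd.2

-- The pairs across the cut avoid the diagonal, so each is independently an edge with probability p,
-- and 1 + p(e^t - 1) ≤ exp(p(e^t - 1)).
open scoped Classical in
lemma lintegral_exp_card_interedges_le (p : I) (S : Finset (Fin n)) (t : ℝ) :
    ∫⁻ G, ENNReal.ofReal (Real.exp (t * (G.interedges S Sᶜ).card))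
        ∂(SimpleGraph.binomialRandom (Fin n) p) ≤
      ENNReal.ofReal (Real.exp (p * S.card * (n - S.card) * (Real.exp t - 1))) := by
  set F := (S ×ˢ Sᶜ).image (fun z => s(z.1, z.2)) with hF
  set g : Prop → ℝ≥0∞ := fun P => if P then ENNReal.ofReal (Real.exp t) else 1 with hg
  set ν : Sym2 (Fin n) → Measure Prop := fun e =>
    unitInterval.toNNReal p • Measure.dirac (e ∈ (Sym2.diagSetᶜ : Set (Sym2 (Fin n)))) +
      unitInterval.toNNReal (σ p) • Measure.dirac False with hν
  have hprob : ∀ e, IsProbabilityMeasure (ν e) := by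
    intro e; infer_instance
  have hgm : Measurable g := measurable_of_countable g
  have hnd : ∀ e ∈ F, e ∉ (Sym2.diagSet : Set (Sym2 (Fin n))) := by
    intro e he
    simp only [hF, Finset.mem_image, Finset.mem_product, Finset.mem_compl, Prod.exists] at he
    obtain ⟨a, b, ⟨ha, hb⟩, rfl⟩ := he
    intro hab
    have : a = b := by simpa using hab
    exact hb (this ▸ ha)
  have hcard : F.card = S.card * (n - S.card) := by
    rw [hF, Finset.card_image_of_injOn, Finset.card_product, Finset.card_compl, Fintype.card_fin]
    rintro ⟨a, b⟩ hab ⟨c, d⟩ hcd h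
    simp only [Finset.coe_product, Set.mem_prod, Finset.mem_coe, Finset.mem_compl] at hab hcd
    rcases Sym2.eq_iff.1 h with h | h
    · exact Prod.ext h.1 h.2
    · dsimp only at h
      exact absurd (h.1 ▸ hab.1) hcd.2
  have hstep : ∫⁻ G, ENNReal.ofReal (Real.exp (t * (G.interedges S Sᶜ).card))
        ∂(SimpleGraph.binomialRandom (Fin n) p) =
      ∫⁻ ω, ∏ e ∈ F, g (ω e) ∂(Measure.infinitePi ν) := by
    rw [SimpleGraph.binomialRandom_eq_map, setBernoulli_eq_map,
      lintegral_map (measurable_of_countable _) (by fun_prop),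
      lintegral_map (measurable_of_countable _) (by fun_prop)]
    refine lintegral_congr fun ω => ?_
    rw [exp_card_interedges]
    refine Finset.prod_congr rfl fun e he => ?_
    have h1 : e ∈ (SimpleGraph.fromEdgeSet {i | ω i}).edgeSet ↔ ω e := by
      rw [SimpleGraph.edgeSet_fromEdgeSet]
      have := hnd e he
      simp_all
    simp only [hg, h1]
  have hind : iIndepFun (fun e (ω : Sym2 (Fin n) → Prop) => g (ω e)) (Measure.infinitePi ν) :=
    iIndepFun_infinitePi (X := fun _ => g) fun _ => hgm
  rw [hstep, lintegral_prod_eq_prod_lintegral_of_indepFun F _ hind fun e => by fun_prop]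
  have hone : ∀ e ∈ F, ∫⁻ ω, g (ω e) ∂(Measure.infinitePi ν) ≤
      ENNReal.ofReal (Real.exp (p * (Real.exp t - 1))) := by
    intro e he
    have h1 : ∫⁻ ω, g (ω e) ∂(Measure.infinitePi ν) = ∫⁻ P, g P ∂(ν e) := by
      rw [← Measure.infinitePi_map_eval ν e, lintegral_map hgm (by fun_prop)]
    have h2 := hnd e he
    have h3 : ∫⁻ P, g P ∂(ν e) = ENNReal.ofReal (p * Real.exp t + (1 - p)) := by
      rw [hν, lintegral_add_measure, lintegral_smul_measure, lintegral_smul_measure,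
        lintegral_dirac, lintegral_dirac, ENNReal.ofReal_add (mul_nonneg p.2.1 (Real.exp_pos _).le)
          (by linarith [p.2.2]), ENNReal.ofReal_mul p.2.1]
      have hp : ENNReal.ofReal (p : ℝ) = (unitInterval.toNNReal p : ℝ≥0∞) := by
        rw [ENNReal.ofReal, Real.toNNReal_of_nonneg p.2.1]; rfl
      have hp' : ENNReal.ofReal (1 - (p : ℝ)) = (unitInterval.toNNReal (σ p) : ℝ≥0∞) := by
        rw [ENNReal.ofReal, Real.toNNReal_of_nonneg (by linarith [p.2.2])]; rfl
      rw [hp, hp']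
      simp [hg, h2, ENNReal.smul_def]
    rw [h1, h3]
    refine ENNReal.ofReal_le_ofReal ?_
    linarith [Real.add_one_le_exp (p * (Real.exp t - 1))]
  refine (Finset.prod_le_prod' hone).trans (le_of_eq ?_)
  rw [Finset.prod_const, hcard, ← ENNReal.ofReal_pow (Real.exp_pos _).le, ← Real.exp_nat_mul]
  have hle : S.card ≤ n := by simpa using Finset.card_le_univ S
  push_cast [hle]
  congr 2
  ring

/-- Taylor's formula with cubic remainder (2/9)|x|³ ≤ (1/6)x², and 1/2 + 1/6 = 2/3. -/
lemma exp_sub_one_sub_le {x : ℝ} (hx : |x| ≤ 3 / 4) : Real.exp x - 1 - x ≤ 2 / 3 * x ^ 2 := by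
  have h := Real.exp_bound (x := x) (by linarith) (n := 3) (by norm_num)
  have h2 := (abs_le.1 h).2
  simp only [Finset.sum_range_succ, Finset.sum_range_zero] at h2
  norm_num [Nat.factorial] at h2
  have h3 : |x| ^ 3 ≤ 3 / 4 * x ^ 2 := by
    rw [pow_succ, sq_abs, mul_comm]
    exact mul_le_mul_of_nonneg_right hx (sq_nonneg x)
  linarith

open scoped Classical in
/-- A Chernoff bound for the number of edges in a cut. -/
lemma binomialRandom_cut_le (p : I) (S : Finset (Fin n)) {ε : ℝ} (hε : 0 ≤ ε) (hε' : ε ≤ 3 / 4) :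
    SimpleGraph.binomialRandom (Fin n) p {G | ε * (p * S.card * (n - S.card)) <
        |((G.interedges S Sᶜ).card : ℝ) - p * S.card * (n - S.card)|} ≤
      2 * ENNReal.ofReal (Real.exp (-(ε ^ 2 / 3 * (p * S.card * (n - S.card))))) := by
  set m : ℝ := p * S.card * (n - S.card) with hm
  have hm0 : 0 ≤ m := by
    have hle : (S.card : ℝ) ≤ n := by exact_mod_cast by simpa using Finset.card_le_univ S
    have := p.2.1
    exact mul_nonneg (mul_nonneg this (Nat.cast_nonneg _)) (by linarith)
  -- Both tails at once, with t = ε and t = -ε; the exponent is at most (2/3 - 1)ε²m.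
  have htail : ∀ t : ℝ, |t| = ε → SimpleGraph.binomialRandom (Fin n) p
      {G | t * m + ε ^ 2 * m ≤ t * (G.interedges S Sᶜ).card} ≤
      ENNReal.ofReal (Real.exp (-(ε ^ 2 / 3 * m))) := by
    intro t ht
    have h1 := meas_ge_le_lintegral_div (μ := SimpleGraph.binomialRandom (Fin n) p)
      (f := fun G => ENNReal.ofReal (Real.exp (t * (G.interedges S Sᶜ).card)))
      (measurable_of_countable _).aemeasurable
      (ε := ENNReal.ofReal (Real.exp (t * m + ε ^ 2 * m))) (by simp [Real.exp_pos])
      ENNReal.ofReal_ne_top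
    have hset : {G : SimpleGraph (Fin n) | t * m + ε ^ 2 * m ≤ t * (G.interedges S Sᶜ).card} =
        {G | ENNReal.ofReal (Real.exp (t * m + ε ^ 2 * m)) ≤
          ENNReal.ofReal (Real.exp (t * (G.interedges S Sᶜ).card))} := by
      ext G
      simp only [Set.mem_ofPred_eq]
      rw [ENNReal.ofReal_le_ofReal_iff (Real.exp_pos _).le, Real.exp_le_exp]
    rw [hset]
    refine (h1.trans (ENNReal.div_le_div_right
      (lintegral_exp_card_interedges_le p S t) _)).trans ?_
    rw [← ENNReal.ofReal_div_of_pos (Real.exp_pos _), ← Real.exp_sub]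
    refine ENNReal.ofReal_le_ofReal (Real.exp_le_exp.2 ?_)
    have h2 := exp_sub_one_sub_le (x := t) (by linarith)
    have h3 : t ^ 2 = ε ^ 2 := by rw [← ht, sq_abs]
    rw [h3] at h2
    nlinarith [mul_le_mul_of_nonneg_left h2 hm0]
  refine (measure_mono (t := {G | ε * m + ε ^ 2 * m ≤ ε * (G.interedges S Sᶜ).card} ∪
    {G | (-ε) * m + ε ^ 2 * m ≤ (-ε) * (G.interedges S Sᶜ).card}) ?_).trans
      ((measure_union_le _ _).trans ?_)
  · intro G hG
    simp only [Set.mem_ofPred_eq, Set.mem_union] at hG ⊢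
    rcases lt_abs.1 hG with h | h
    · left; nlinarith
    · right; nlinarith
  · rw [two_mul]
    exact add_le_add (htail ε (abs_of_nonneg hε)) (htail (-ε) (by rw [abs_neg, abs_of_nonneg hε]))

/-- A binomial random graph has uniform cuts with high probability. -/
lemma binomialRandom_not_uniformCuts_le (hn : 1 ≤ n) (p : I) {a : ℝ} (ha : 16 ≤ a)
    (hp : (p : ℝ) = a * Real.log n / n) :
    SimpleGraph.binomialRandom (Fin n) p {G | ¬ UniformCuts G a} ≤
      ENNReal.ofReal (2 * ((1 + Real.exp (-(4 / 3 * Real.log n))) ^ n - 1)) := by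
  classical
  set x := Real.exp (-(4 / 3 * Real.log n)) with hx
  set ε := √(8 / a) with hε
  have hε0 : 0 ≤ ε := Real.sqrt_nonneg _
  have hε2 : ε ^ 2 = 8 / a := Real.sq_sqrt (by positivity)
  have hε1 : ε ≤ 3 / 4 := by
    rw [hε, Real.sqrt_le_left (by norm_num), div_le_iff₀ (by linarith)]
    linarith
  have hn0 : (0 : ℝ) < n := by exact_mod_cast hn
  have hlog : 0 ≤ Real.log n := Real.log_nonneg (by exact_mod_cast hn)
  set bad : Finset (Fin n) → Set (SimpleGraph (Fin n)) := fun S =>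
    {G | ε * (p * S.card * (n - S.card)) <
        |((G.interedges S Sᶜ).card : ℝ) - p * S.card * (n - S.card)|} with hbad
  -- A set and its complement have the same cut, so the union bound may be restricted to nonempty
  -- sets of at most n/2 nodes.
  have hcompl : ∀ S, bad Sᶜ = bad S := by
    intro S
    have hle : S.card ≤ n := by simpa using Finset.card_le_univ S
    ext G
    simp only [hbad, Set.mem_ofPred_eq]
    rw [card_interedges_compl, Finset.card_compl, Fintype.card_fin]
    push_cast [hle]
    rw [show (p : ℝ) * (n - S.card) * (n - (n - S.card)) = p * S.card * (n - S.card) by ring]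
  have hempty : bad ∅ = ∅ := by
    ext G
    simp [hbad, SimpleGraph.interedges, Rel.interedges]
  set 𝒮 : Finset (Finset (Fin n)) :=
    Finset.univ.filter fun S => S.Nonempty ∧ 2 * S.card ≤ n with h𝒮
  have hsub : {G | ¬ UniformCuts G a} ⊆ ⋃ S ∈ 𝒮, bad S := by
    intro G hG
    simp only [Set.mem_ofPred_eq, UniformCuts, not_forall, not_le] at hG
    obtain ⟨S, hS⟩ := hG
    have hGS : G ∈ bad S := by
      simp only [hbad, Set.mem_ofPred_eq, hp]
      convert hS
    have hmem : ∀ R : Finset (Fin n), G ∈ bad R → 2 * R.card ≤ n → G ∈ ⋃ S ∈ 𝒮, bad S := by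
      intro R hR hRc
      refine Set.mem_biUnion (x := R) ?_ hR
      have hne : R.Nonempty := by
        rw [Finset.nonempty_iff_ne_empty]
        rintro rfl
        rw [hempty] at hR
        exact hR
      simp [h𝒮, hne, hRc]
    rcases le_total (2 * S.card) n with h | h
    · exact hmem S hGS h
    · refine hmem Sᶜ (by rwa [hcompl]) ?_
      rw [Finset.card_compl, Fintype.card_fin]
      omega
  have hone : ∀ S ∈ 𝒮, SimpleGraph.binomialRandom (Fin n) p (bad S) ≤
      ENNReal.ofReal (2 * x ^ S.card) := by
    intro S hS
    simp only [h𝒮, Finset.mem_filter, Finset.mem_univ, true_and] at hS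
    refine (binomialRandom_cut_le p S hε0 hε1).trans ?_
    rw [ENNReal.ofReal_mul (by norm_num), ENNReal.ofReal_ofNat]
    gcongr
    rw [hx, ← Real.exp_nat_mul, hε2, hp]
    refine Real.exp_le_exp.2 ?_
    have h2 : 2 * (S.card : ℝ) ≤ n := by exact_mod_cast hS.2
    have h3 : (n : ℝ) / 2 ≤ n - S.card := by linarith
    -- The constant 8 in ε enters here: with n - |S| ≥ n/2 the exponent is at least (4/3)|S| ln n,
    -- and 4/3 > 1 beats the number of sets.
    have e1 : 8 / a / 3 * (a * Real.log n / n * S.card * (n - S.card)) =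
        8 / 3 * Real.log n * S.card / n * (n - S.card) := by
      have : a ≠ 0 := by linarith
      field_simp
    have h4 : 8 / 3 * Real.log n * S.card / n * (n / 2) ≤
        8 / 3 * Real.log n * S.card / n * (n - S.card) := by
      gcongr
    have e2 : 8 / 3 * Real.log n * S.card / n * (n / 2) = S.card * (4 / 3 * Real.log n) := by
      field_simp
      ring
    rw [e1]
    linarith
  refine (measure_mono hsub).trans ((measure_biUnion_finset_le _ _).trans
    ((Finset.sum_le_sum hone).trans ?_))
  have hx0 : 0 ≤ x := (Real.exp_pos _).le
  rw [← ENNReal.ofReal_sum_of_nonneg fun S _ => by positivity, ← Finset.mul_sum]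
  refine ENNReal.ofReal_le_ofReal (mul_le_mul_of_nonneg_left ?_ (by norm_num))
  have hall : ∑ S : Finset (Fin n), x ^ S.card = (1 + x) ^ n := by
    have := Finset.sum_pow_mul_eq_add_pow x 1 (Finset.univ : Finset (Fin n))
    simpa [add_comm] using this
  -- The empty set, absent from `𝒮`, accounts for the subtracted 1.
  have hins : ∑ S ∈ 𝒮, x ^ S.card + 1 ≤ ∑ S : Finset (Fin n), x ^ S.card := by
    have h1 : (∅ : Finset (Fin n)) ∉ 𝒮 := by simp [h𝒮]
    have h2 : ∑ S ∈ insert ∅ 𝒮, x ^ S.card = 1 + ∑ S ∈ 𝒮, x ^ S.card := by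
      rw [Finset.sum_insert h1]; simp
    rw [add_comm, ← h2]
    exact Finset.sum_le_sum_of_subset_of_nonneg (Finset.subset_univ _) fun S _ _ => by positivity
  linarith

/-- (1 + n^(-4/3))^n ≤ exp(n^(-1/3)), which tends to 1. -/
lemma tendsto_union_bound :
    Tendsto (fun n : ℕ => 2 * ((1 + Real.exp (-(4 / 3 * Real.log n))) ^ n - 1)) atTop (𝓝 0) := by
  have h1 : Tendsto (fun n : ℕ => 2 * (Real.exp (Real.exp (-(1 / 3 * Real.log n))) - 1))
      atTop (𝓝 0) := by
    have h2 : Tendsto (fun n : ℕ => -(1 / 3 * Real.log n)) atTop atBot :=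
      tendsto_neg_atTop_atBot.comp ((Real.tendsto_log_atTop.comp
        tendsto_natCast_atTop_atTop).const_mul_atTop (by norm_num))
    have h3 := (Real.continuous_exp.tendsto 0).comp (Real.tendsto_exp_atBot.comp h2)
    have h4 := (h3.sub_const 1).const_mul 2
    simpa using h4
  refine tendsto_of_tendsto_of_tendsto_of_le_of_le' tendsto_const_nhds h1 ?_ ?_
  · filter_upwards with n
    have : (1 : ℝ) ≤ (1 + Real.exp (-(4 / 3 * Real.log n))) ^ n :=
      one_le_pow₀ (by linarith [Real.exp_pos (-(4 / 3 * Real.log n))])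
    linarith
  · filter_upwards [eventually_ge_atTop 1] with n hn
    have hn0 : (0 : ℝ) < n := by exact_mod_cast hn
    have h5 : (1 + Real.exp (-(4 / 3 * Real.log n))) ^ n ≤
        Real.exp (Real.exp (-(1 / 3 * Real.log n))) := by
      have h6 : 1 + Real.exp (-(4 / 3 * Real.log n)) ≤
          Real.exp (Real.exp (-(4 / 3 * Real.log n))) := by
        linarith [Real.add_one_le_exp (Real.exp (-(4 / 3 * Real.log n)))]
      refine (pow_le_pow_left₀ (by positivity) h6 n).trans (le_of_eq ?_)
      rw [← Real.exp_nat_mul]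
      congr 1
      nth_rw 1 [← Real.exp_log hn0]
      rw [← Real.exp_add]
      congr 1
      ring
    linarith

/-! ### Graphs with uniform cuts -/

lemma harmonic_pred_le (hn : 3 ≤ n) : (harmonic (n - 1) : ℝ) ≤ 2 * Real.log n := by
  have h1 := harmonic_le_one_add_log (n - 1)
  have hn3 : (3 : ℝ) ≤ n := by exact_mod_cast hn
  have h2 : Real.log ((n - 1 : ℕ) : ℝ) ≤ Real.log n :=
    Real.log_le_log (by exact_mod_cast (by omega : 0 < n - 1)) (by exact_mod_cast Nat.sub_le n 1)
  have h3 : 1 ≤ Real.log n := by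
    rw [Real.le_log_iff_exp_le (by linarith)]
    linarith [Real.exp_one_lt_d9]
  linarith

/-- Mean and concentration of the spreading time in a graph with uniform cuts. -/
lemma UniformCuts.meanBound_and_concentration {G : SimpleGraph (Fin n)} {a : ℝ}
    (h : UniformCuts G a) (ha : 12800 ≤ a) (hn : 3 ≤ n) (s : Fin n) :
    MeanBound 50 a G s ∧ ∀ x : ℝ,
      protocolLaw G (concentrationEvent (50 * (Real.log n / √a) + x) G s)ᶜ ≤
        ENNReal.ofReal (2 * Real.exp (1 - x / 4)) := by
  have ha0 : 0 < a := by linarith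
  set ε := √(8 / a) with hε
  have hε0 : 0 < ε := Real.sqrt_pos.2 (by positivity)
  have hε1 : ε ≤ 1 / 40 := by
    rw [hε, Real.sqrt_le_left (by norm_num), div_le_iff₀ ha0]
    linarith
  have hn3 : (3 : ℝ) ≤ n := by exact_mod_cast hn
  have hn1 : (0 : ℝ) < n - 1 := by linarith
  have hlog : 0 < Real.log n := Real.log_pos (by linarith)
  set r := (1 - ε) / (1 + ε) with hr
  have hr12 : 1 / 2 ≤ r := by rw [hr, div_le_div_iff₀ (by norm_num) (by linarith)]; linarith
  have hr1 : r ≤ 1 := by rw [hr, div_le_one (by linarith)]; linarith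
  have hr0 : 0 < r := by linarith
  have hri : r⁻¹ = (1 + ε) / (1 - ε) := by rw [hr, inv_div]
  have hb := fun S => h.growthRate_mem ha0 (by linarith) (by omega) S
  obtain ⟨hfin, hlow, hupp, htail⟩ := spreadTime_mean_and_tail hr12 hr1 (by omega)
    (fun S => (hb S).1) (fun S => by rw [hri]; exact (hb S).2) s
  set H := (harmonic (n - 1) : ℝ) with hH
  have hHpos : 0 < H := by
    rw [hH]
    exact_mod_cast harmonic_pos (by omega)
  have hHle : H ≤ 2 * Real.log n := harmonic_pred_le hn
  set E := (meanSpreadTime G s).toReal with hE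
  -- Here 2/(1-ε) ≤ 2.06 because ε ≤ 1/40, which is the condition a ≥ 12800.
  have hri2 : r⁻¹ ≤ 1 + 2.06 * ε := by
    rw [hri, div_le_iff₀ (by linarith)]
    nlinarith
  have hrl : 1 - 2 * ε ≤ r := by
    rw [hr, le_div_iff₀ (by linarith)]
    nlinarith
  have hc0 : 0 < ((n : ℝ) - 1) / n := by positivity
  constructor
  -- Rescaling the mean removes the factor (n-1)/n in front of the harmonic number; the error
  -- E/(n-1) is of order ln n / n.
  · refine ⟨hfin, n / (n - 1) * E, ?_, ?_⟩
    · have e1 : (n : ℝ) / (n - 1) * (r * ((n - 1) / n * H)) = r * H := by field_simp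
      have e2 : (n : ℝ) / (n - 1) * (r⁻¹ * ((n - 1) / n * H)) = r⁻¹ * H := by field_simp
      have h1 : r * H ≤ n / (n - 1) * E := by rw [← e1]; gcongr
      have h2 : n / (n - 1) * E ≤ r⁻¹ * H := by rw [← e2]; gcongr
      -- The constant 34 exceeds 2.06² · 8 = 33.9488.
      have h3 : 2.06 * ε < √(34 / a) := by
        refine Real.lt_sqrt_of_sq_lt ?_
        rw [mul_pow, hε, Real.sq_sqrt (by positivity), ← mul_div_assoc]
        gcongr
        norm_num
      have h4 : 2.06 * ε * H < √(34 / a) * H := mul_lt_mul_of_pos_right h3 hHpos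
      rw [abs_lt]
      constructor <;> nlinarith [mul_pos hε0 hHpos]
    · have hE0 : 0 ≤ E := ENNReal.toReal_nonneg
      have e3 : E - n / (n - 1) * E = -(E / (n - 1)) := by field_simp; ring
      rw [e3, abs_neg, abs_of_nonneg (by positivity), div_le_iff₀ hn1]
      have h5 : r⁻¹ * ((n - 1) / n * H) ≤ 2 * ((n - 1) / n * (2 * Real.log n)) := by
        gcongr
        linarith
      have e4 : 50 * (Real.log n / n) * (n - 1) = 50 * ((n - 1) / n * Real.log n) := by ring
      rw [e4]
      have : 0 < (n - 1) / n * Real.log n := by positivity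
      linarith
  · intro x
    rw [ENNReal.ofReal_mul (by norm_num), ENNReal.ofReal_ofNat]
    refine (measure_mono fun ω hω => ?_).trans (htail x)
    intro hcon
    refine hω ⟨hfin, hcon.1, ?_⟩
    have hA : (n - 1) / n * H ≤ 2 * Real.log n := by
      have : ((n : ℝ) - 1) / n ≤ 1 := by rw [div_le_one (by linarith)]; linarith
      nlinarith
    have hA0 : 0 < (n - 1) / n * H := by positivity
    have hsq : ε ≤ 3 / √a := by
      rw [hε, Real.sqrt_div (by norm_num)]
      gcongr
      rw [Real.sqrt_le_left (by norm_num)]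
      norm_num
    -- The mean lies between rA and A/r, and off the exceptional event T exceeds this range by less
    -- than x, so the width of the range plus x bounds their distance.
    have hgap : r⁻¹ * ((n - 1) / n * H) - r * ((n - 1) / n * H) ≤ 50 * (Real.log n / √a) := by
      calc r⁻¹ * ((n - 1) / n * H) - r * ((n - 1) / n * H) = (r⁻¹ - r) * ((n - 1) / n * H) := by
            ring
        _ ≤ (5 * (3 / √a)) * (2 * Real.log n) := by
            gcongr
            linarith
        _ = 30 * (Real.log n / √a) := by ring
        _ ≤ _ := by
            gcongr
            norm_num
    rw [abs_le]
    have := hcon.2.1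
    have := hcon.2.2
    constructor <;> linarith

lemma ofReal_one_sub_le_of_compl {Ω : Type*} [MeasurableSpace Ω] {μ : Measure Ω}
    [IsProbabilityMeasure μ] {E : Set Ω} {δ : ℝ} (hδ : 0 ≤ δ) (h : μ Eᶜ ≤ ENNReal.ofReal δ) :
    ENNReal.ofReal (1 - δ) ≤ μ E := by
  have h1 : 1 ≤ μ E + μ Eᶜ := by
    rw [← measure_univ (μ := μ), ← Set.union_compl_self E]
    exact measure_union_le _ _
  rw [ENNReal.ofReal_sub _ hδ, ENNReal.ofReal_one]
  exact tsub_le_iff_right.2 (h1.trans (by gcongr))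

/-- Concentration of the spreading time, uniformly over all large graphs with uniform cuts. -/
lemma eventually_concentration {α : ℕ → ℝ} (hα : Tendsto α atTop atTop) {ψ : ℕ → ℝ}
    (hψ : Tendsto ψ atTop atTop) {δ : ℝ} (hδ : 0 < δ) :
    ∀ᶠ n : ℕ in atTop, ∀ G : SimpleGraph (Fin n), UniformCuts G (α n) →
      ∀ s, ENNReal.ofReal (1 - δ) ≤
        protocolLaw G (concentrationEvent (50 * (Real.log n / √(α n)) + ψ n) G s) := by
  have hlim : Tendsto (fun n => 2 * Real.exp (1 - ψ n / 4)) atTop (𝓝 0) := by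
    have h1 : Tendsto (fun n => 1 - ψ n / 4) atTop atBot := by
      simp only [sub_eq_add_neg]
      exact tendsto_atBot_add_const_left _ _
        (tendsto_neg_atTop_atBot.comp (hψ.atTop_div_const (by norm_num)))
    simpa using (Real.tendsto_exp_atBot.comp h1).const_mul 2
  filter_upwards [hα.eventually_ge_atTop 12800, eventually_ge_atTop 3,
    hlim.eventually_le_const hδ] with n ha hn hψn G hG s
  refine ofReal_one_sub_le_of_compl hδ.le ?_
  exact ((hG.meanBound_and_concentration ha hn s).2 (ψ n)).trans (ENNReal.ofReal_le_ofReal hψn)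

lemma eventually_binomialRandom_uniformCuts {α : ℕ → ℝ} (hα : Tendsto α atTop atTop) {p : ℕ → I}
    (hp : ∀ᶠ n : ℕ in atTop, (p n : ℝ) = α n * Real.log n / n) {δ : ℝ} (hδ : 0 < δ) :
    ∀ᶠ n : ℕ in atTop, ENNReal.ofReal (1 - δ) ≤
      SimpleGraph.binomialRandom (Fin n) (p n) {G | UniformCuts G (α n)} := by
  filter_upwards [hα.eventually_ge_atTop 16, eventually_ge_atTop 1, hp,
    tendsto_union_bound.eventually_le_const hδ] with n ha hn hpn hle
  refine ofReal_one_sub_le_of_compl hδ.le ?_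
  exact (binomialRandom_not_uniformCuts_le hn (p n) ha hpn).trans (ENNReal.ofReal_le_ofReal hle)

end RumorSpreading

open RumorSpreading in
theorem theorem1 (α : ℕ → ℝ) (hα : Tendsto α atTop atTop) :
    ∃ C : ℝ,
      -- the random graph with edge probability `p = α ln n / n`
      (∀ p : ℕ → I, (∀ᶠ n : ℕ in atTop, (p n : ℝ) = α n * Real.log n / n) →
        Tendsto
            (fun n : ℕ => SimpleGraph.binomialRandom (Fin n) (p n)
              {G | ∀ s, MeanBound C (α n) G s})
            atTop (𝓝 1) ∧
          ∀ ψ : ℕ → ℝ, Tendsto ψ atTop atTop → ∀ δ : ℝ, 0 < δ →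
            ∀ᶠ n : ℕ in atTop, ∀ s : SimpleGraph (Fin n) → Fin n,
              ENNReal.ofReal (1 - δ) ≤
                ∫⁻ G, protocolLaw G
                    (concentrationEvent (C * (Real.log n / √(α n)) + ψ n) G (s G))
                  ∂(SimpleGraph.binomialRandom (Fin n) (p n))) ∧
      -- every graph with uniform cuts
      (∀ᶠ n : ℕ in atTop, ∀ G : SimpleGraph (Fin n), UniformCuts G (α n) →
        ∀ s, MeanBound C (α n) G s) ∧
      (∀ ψ : ℕ → ℝ, Tendsto ψ atTop atTop → ∀ δ : ℝ, 0 < δ →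
        ∀ᶠ n : ℕ in atTop, ∀ G : SimpleGraph (Fin n), UniformCuts G (α n) →
          ∀ s, ENNReal.ofReal (1 - δ) ≤
            protocolLaw G
              (concentrationEvent (C * (Real.log n / √(α n)) + ψ n) G s)) := by

  have hmean : ∀ᶠ n : ℕ in atTop, ∀ G : SimpleGraph (Fin n), UniformCuts G (α n) →
      ∀ s, MeanBound 50 (α n) G s := by
    filter_upwards [hα.eventually_ge_atTop 12800, eventually_ge_atTop 3] with n ha hn G hG s
    exact (hG.meanBound_and_concentration ha hn s).1
  refine ⟨50, fun p hp => ⟨?_, fun ψ hψ δ hδ => ?_⟩, hmean, fun ψ hψ δ hδ =>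
    eventually_concentration hα hψ hδ⟩
  · refine tendsto_order.2 ⟨fun a ha => ?_, fun a ha => Eventually.of_forall fun n =>
      prob_le_one.trans_lt ha⟩
    have hat : a ≠ ∞ := (ha.trans ENNReal.one_lt_top).ne
    have har : a.toReal < 1 := by
      simpa using (ENNReal.toReal_lt_toReal hat ENNReal.one_ne_top).2 ha
    filter_upwards [hmean, eventually_binomialRandom_uniformCuts hα hp
      (δ := (1 - a.toReal) / 2) (by linarith)] with n hm hu
    refine lt_of_lt_of_le ?_ (hu.trans (measure_mono fun G hG => hm G hG))
    exact (ENNReal.lt_ofReal_iff_toReal_lt hat).2 (by linarith)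
  -- For δ < 1, one half of δ pays for the graph and one half for the protocol: (1 - δ/2)² ≥ 1 - δ.
  · rcases le_or_gt 1 δ with h1 | h1
    · refine Eventually.of_forall fun n s => ?_
      rw [ENNReal.ofReal_of_nonpos (by linarith)]
      exact zero_le
    filter_upwards [eventually_concentration hα hψ (half_pos hδ),
      eventually_binomialRandom_uniformCuts hα hp (half_pos hδ)] with n hc hu s
    calc ENNReal.ofReal (1 - δ) ≤ ENNReal.ofReal (1 - δ / 2) * ENNReal.ofReal (1 - δ / 2) := by
          rw [← ENNReal.ofReal_mul (by linarith)]
          exact ENNReal.ofReal_le_ofReal (by nlinarith)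
      _ ≤ ENNReal.ofReal (1 - δ / 2) *
          SimpleGraph.binomialRandom (Fin n) (p n) {G | UniformCuts G (α n)} := by gcongr
      _ = ∫⁻ _ in {G | UniformCuts G (α n)}, ENNReal.ofReal (1 - δ / 2)
            ∂(SimpleGraph.binomialRandom (Fin n) (p n)) := by rw [setLIntegral_const]
      _ ≤ ∫⁻ G in {G | UniformCuts G (α n)}, protocolLaw G
            (concentrationEvent (50 * (Real.log n / √(α n)) + ψ n) G (s G))
            ∂(SimpleGraph.binomialRandom (Fin n) (p n)) :=
          setLIntegral_mono (measurable_of_countable _) fun G hG => hc G hG (s G)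
      _ ≤ _ := setLIntegral_le_lintegral _ _
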